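/- Let $N\ge 1$, let $\Omega\subset\mathbb R^N$ be a bounded domain with smooth boundary, let $T\in(0,\infty)$, $1<p,q<2$, $m,n>0$, and let $u_0,v_0:\Omega\to\mathbb R$ be initial data (no regularity of $u_0,v_0$ is needed). Write $Q_T=\Omega\times(0,T)$, $\Gamma_T=\partial\Omega\times(0,T)$, and consider the problem $$\begin{cases}u_t=\operatorname{div}(|\nabla u|^{p-2}\nabla u)+v^m,\quad v_t=\operatorname{div}(|\nabla v|^{q-2}\nabla v)+u^n & \text{in } Q_T,\\ u=v=0 & \text{on }\Gamma_T,\\ u(\cdot,0)=u_0,\quad v(\cdot,0)=v_0 & \text{in }\Omega.\end{cases}\tag{P}$$ For $s\in\{p,q\}$ let $E_{s0}$ be the set of $w\in L^2(Q_T)$ with weak spatial gradient $\nabla w\in L^s(Q_T)$ and zero trace on $\Gamma_T$. A pair $(u,v)$ of functions on $Q_T$ that are nonnegative almost everywhere is called a *weak subsolution* of (P) in $Q_T$ if $$u\in L^{2n}(Q_T)\cap L^2(Q_T),\quad u_t\in L^2(Q_T),\quad \nabla u\in L^p(Q_T),$$ $$v\in L^{2m}(Q_T)\cap L^2(Q_T),\quad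 v_t\in L^2(Q_T),\quad \nabla v\in L^q(Q_T)$$ (weak derivatives), if for all $\phi_1\in E_{p0}$ and $\phi_2\in E_{q0}$ with $\phi_1,\phi_2\ge 0$ a.e. $$\iint_{Q_T}\big(u_t\phi_1+|\nabla u|^{p-2}\nabla u\cdot\nabla\phi_1\big)\,dx\,dt\le\iint_{Q_T}v^m\phi_1\,dx\,dt,$$ $$\iint_{Q_T}\big(v_t\phi_2+|\nabla v|^{q-2}\nabla v\cdot\nabla\phi_2\big)\,dx\,dt\le\iint_{Q_T}u^n\phi_2\,dx\,dt,$$ and if $u\le 0$, $v\le 0$ on $\Gamma_T$ in the sense of traces and $u(\cdot,0)\le u_0$, $v(\cdot,0)\le v_0$ a.e. in $\Omega$, where $u(\cdot,0)$, $v(\cdot,0)$ are the limits of $u(\cdot,t)$, $v(\cdot,t)$ in $L^2(\Omega)$ as $t\to0^+$. A *weak supersolution* is a pair of a.e. nonnegative functions in the same spaces that satisfies these conditions with the two integral inequalities and the boundary and initial inequalities reversed (still for all $\phi_1,\phi_2\ge0$). Let $(\overline u,\overline v)$ be a weak supersolution and $(\underline u,\underline v)$ a weak subsolution of (P) in $Q_T$,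 all four functions being essentially bounded in $Q_T$. 1. If there is a constant $\delta>0$ such that $\overline u\ge\delta$ and $\overline v\ge\delta$ a.e. in $Q_T$, then $\overline u\ge\underline u$ and $\overline v\ge\underline v$ a.e. in $Q_T$. 2. If $m\ge1$ and $n\ge1$, then $\overline u\ge\underline u$ and $\overline v\ge\underline v$ a.e. in $Q_T$, without any positive lower bound on $(\overline u,\overline v)$. -/

import Mathlib

open MeasureTheory Set Filter Topology
open scoped ENNReal ContDiff

noncomputable section

namespace FastDiffusion

/-- The Euclidean space `ℝ^N`. -/
abbrev Space (N : ℕ) : Type := EuclideanSpace ℝ (Fin N)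

/-- Space-time `ℝ^N × ℝ`; its points are written `(x, t)`. -/
abbrev SpaceTime (N : ℕ) : Type := Space N × ℝ

variable {N : ℕ}

/-- `Ω` has a smooth boundary: near each boundary point it is the sublevel set `{ρ < 0}` of a
smooth function `ρ` whose differential does not vanish at that point. -/
def HasSmoothBoundary (Ω : Set (Space N)) : Prop :=
  ∀ x ∈ frontier Ω, ∃ (U : Set (Space N)) (ρ : Space N → ℝ),
    IsOpen U ∧ x ∈ U ∧ ContDiff ℝ ∞ ρ ∧ fderiv ℝ ρ x ≠ 0 ∧ Ω ∩ U = {y ∈ U | ρ y < 0}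

/-- A bounded domain (nonempty connected open set) with smooth boundary. -/
structure IsBoundedSmoothDomain (Ω : Set (Space N)) : Prop where
  isOpen : IsOpen Ω
  isConnected : IsConnected Ω
  isBounded : Bornology.IsBounded Ω
  smoothBoundary : HasSmoothBoundary Ω

/-- The cylinder `Q_T = Ω × (0, T)`. -/
def cylinder (Ω : Set (Space N)) (T : ℝ) : Set (SpaceTime N) := Ω ×ˢ Ioo 0 T

/-- Lebesgue measure on `Q_T`. -/
def cylMeasure (Ω : Set (Space N)) (T : ℝ) : Measure (SpaceTime N) :=
  volume.restrict (cylinder Ω T)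

/-- The surface measure of the lateral boundary `Γ_T = ∂Ω × (0, T)`: the product of the
`(N-1)`-dimensional Hausdorff measure on `∂Ω` and Lebesgue measure on `(0, T)`. -/
def lateralMeasure (Ω : Set (Space N)) (T : ℝ) : Measure (SpaceTime N) :=
  ((Measure.hausdorffMeasure ((N : ℝ) - 1)).restrict (frontier Ω)).prod
    (volume.restrict (Ioo 0 T))

/-- `g` is the weak derivative of `w` in `Q_T` in the space-time direction `d`. -/
def HasWeakDeriv (Ω : Set (Space N)) (T : ℝ) (d : SpaceTime N) (w g : SpaceTime N → ℝ) : Prop :=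
  ∀ φ : SpaceTime N → ℝ, ContDiff ℝ ∞ φ → HasCompactSupport φ → tsupport φ ⊆ cylinder Ω T →
    ∫ z, w z * fderiv ℝ φ z d ∂(cylMeasure Ω T) = -∫ z, g z * φ z ∂(cylMeasure Ω T)

/-- `g` is the weak time derivative `∂w/∂t` of `w` in `Q_T`. -/
def HasWeakTimeDeriv (Ω : Set (Space N)) (T : ℝ) (w g : SpaceTime N → ℝ) : Prop :=
  HasWeakDeriv Ω T (0, 1) w g

/-- `G` is the weak spatial gradient `∇w` of `w` in `Q_T`. -/
def HasWeakGrad (Ω : Set (Space N)) (T : ℝ) (w : SpaceTime N → ℝ)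
    (G : SpaceTime N → Space N) : Prop :=
  ∀ i : Fin N, HasWeakDeriv Ω T (EuclideanSpace.single i 1, 0) w (fun z => G z i)

/-- The classical spatial gradient of a function on space-time. -/
def spatialGrad (φ : SpaceTime N → ℝ) (z : SpaceTime N) : Space N :=
  gradient (fun x => φ (x, z.2)) z.1

/-- `g ∈ L^p(Γ_T)` is the trace on `Γ_T` of `w`, where `w, ∇w ∈ L^p(Q_T)` and `G = ∇w`.  The trace
operator is the continuous extension of the restriction map `φ ↦ φ|_{Γ_T}` from functions smooth up
to the boundary, so `g` is the `L^p(Γ_T)` limit of the restrictions of smooth functions which,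
with their gradients, converge to `w` and `∇w` in `L^p(Q_T)`. -/
def HasTrace (Ω : Set (Space N)) (T p : ℝ) (w : SpaceTime N → ℝ) (G : SpaceTime N → Space N)
    (g : SpaceTime N → ℝ) : Prop :=
  MemLp g (ENNReal.ofReal p) (lateralMeasure Ω T) ∧
  ∃ φ : ℕ → SpaceTime N → ℝ, (∀ k, ContDiff ℝ ∞ (φ k)) ∧
    Tendsto (fun k => eLpNorm (fun z => φ k z - w z) (ENNReal.ofReal p) (cylMeasure Ω T))
      atTop (𝓝 0) ∧
    Tendsto (fun k => eLpNorm (fun z => spatialGrad (φ k) z - G z) (ENNReal.ofReal p)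
      (cylMeasure Ω T)) atTop (𝓝 0) ∧
    Tendsto (fun k => eLpNorm (fun z => φ k z - g z) (ENNReal.ofReal p) (lateralMeasure Ω T))
      atTop (𝓝 0)

/-- `a ∈ L²(Ω)` is the initial value `w(·, 0)`: `w(·, t) → a` in `L²(Ω)` as `t → 0+`, outside a
null set of times.  (A function with `w, ∂w/∂t ∈ L²(Q_T)` is continuous in time with values in
`L²(Ω)` after a change on a null set.) -/
def HasInitialValue (Ω : Set (Space N)) (w : SpaceTime N → ℝ) (a : Space N → ℝ) : Prop :=
  MemLp a 2 (volume.restrict Ω) ∧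
  Tendsto (fun t : ℝ => eLpNorm (fun x => w (x, t) - a x) 2 (volume.restrict Ω))
    (𝓝[>] 0 ⊓ ae volume) (𝓝 0)

/-- `w ∈ L^{2r}(Q_T) ∩ L²(Q_T)` with `∂w/∂t = wt ∈ L²(Q_T)` and `∇w = G ∈ L^p(Q_T)`.  With `r = n`
and exponent `p` this is the space `E_n`; with `r = m` and exponent `q` it is `E_m`. -/
structure MemE (Ω : Set (Space N)) (T r p : ℝ) (w wt : SpaceTime N → ℝ)
    (G : SpaceTime N → Space N) : Prop where
  memLp_two_mul : MemLp w (ENNReal.ofReal (2 * r)) (cylMeasure Ω T)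
  memLp_two : MemLp w 2 (cylMeasure Ω T)
  memLp_timeDeriv : MemLp wt 2 (cylMeasure Ω T)
  memLp_grad : MemLp G (ENNReal.ofReal p) (cylMeasure Ω T)
  timeDeriv : HasWeakTimeDeriv Ω T w wt
  grad : HasWeakGrad Ω T w G

/-- `φ ∈ E_{p0}` with `∇φ = G`: `φ ∈ L²(Q_T)`, `∇φ ∈ L^p(Q_T)`, and `φ` has zero trace. -/
structure MemEZero (Ω : Set (Space N)) (T p : ℝ) (φ : SpaceTime N → ℝ)
    (G : SpaceTime N → Space N) : Prop where
  memLp_two : MemLp φ 2 (cylMeasure Ω T)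
  memLp_grad : MemLp G (ENNReal.ofReal p) (cylMeasure Ω T)
  grad : HasWeakGrad Ω T φ G
  trace : HasTrace Ω T p φ G (fun _ => 0)

/-- `∬_{Q_T} (w_t φ + |∇w|^{p-2} ∇w · ∇φ) dx dt`, where `wt = w_t`, `G = ∇w`, `Gφ = ∇φ`. -/
def weakForm (Ω : Set (Space N)) (T p : ℝ) (wt : SpaceTime N → ℝ) (G : SpaceTime N → Space N)
    (φ : SpaceTime N → ℝ) (Gφ : SpaceTime N → Space N) : ℝ :=
  ∫ z, (wt z * φ z + ‖G z‖ ^ (p - 2) * inner ℝ (G z) (Gφ z)) ∂(cylMeasure Ω T)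

/-- `(u, v)` is a nonnegative weak subsolution in `Q_T` of
`u_t = div(|∇u|^{p-2}∇u) + v^m`, `v_t = div(|∇v|^{q-2}∇v) + u^n`,
with zero lateral boundary data and initial data `(u₀, v₀)`. -/
def IsWeakSubsolution (Ω : Set (Space N)) (T p q m n : ℝ) (u₀ v₀ : Space N → ℝ)
    (u v : SpaceTime N → ℝ) : Prop :=
  (∀ᵐ z ∂(cylMeasure Ω T), 0 ≤ u z ∧ 0 ≤ v z) ∧
  ∃ (ut vt : SpaceTime N → ℝ) (Du Dv : SpaceTime N → Space N),
    MemE Ω T n p u ut Du ∧ MemE Ω T m q v vt Dv ∧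
    (∀ φ Dφ, MemEZero Ω T p φ Dφ → (∀ᵐ z ∂(cylMeasure Ω T), 0 ≤ φ z) →
      weakForm Ω T p ut Du φ Dφ ≤ ∫ z, v z ^ m * φ z ∂(cylMeasure Ω T)) ∧
    (∀ φ Dφ, MemEZero Ω T q φ Dφ → (∀ᵐ z ∂(cylMeasure Ω T), 0 ≤ φ z) →
      weakForm Ω T q vt Dv φ Dφ ≤ ∫ z, u z ^ n * φ z ∂(cylMeasure Ω T)) ∧
    (∃ g, HasTrace Ω T p u Du g ∧ ∀ᵐ z ∂(lateralMeasure Ω T), g z ≤ 0) ∧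
    (∃ g, HasTrace Ω T q v Dv g ∧ ∀ᵐ z ∂(lateralMeasure Ω T), g z ≤ 0) ∧
    (∃ a, HasInitialValue Ω u a ∧ ∀ᵐ x ∂(volume.restrict Ω), a x ≤ u₀ x) ∧
    (∃ a, HasInitialValue Ω v a ∧ ∀ᵐ x ∂(volume.restrict Ω), a x ≤ v₀ x)

/-- `(u, v)` is a nonnegative weak supersolution in `Q_T` of the same problem: all inequalities
between the two sides of the problem are reversed. -/
def IsWeakSupersolution (Ω : Set (Space N)) (T p q m n : ℝ) (u₀ v₀ : Space N → ℝ)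
    (u v : SpaceTime N → ℝ) : Prop :=
  (∀ᵐ z ∂(cylMeasure Ω T), 0 ≤ u z ∧ 0 ≤ v z) ∧
  ∃ (ut vt : SpaceTime N → ℝ) (Du Dv : SpaceTime N → Space N),
    MemE Ω T n p u ut Du ∧ MemE Ω T m q v vt Dv ∧
    (∀ φ Dφ, MemEZero Ω T p φ Dφ → (∀ᵐ z ∂(cylMeasure Ω T), 0 ≤ φ z) →
      ∫ z, v z ^ m * φ z ∂(cylMeasure Ω T) ≤ weakForm Ω T p ut Du φ Dφ) ∧
    (∀ φ Dφ, MemEZero Ω T q φ Dφ → (∀ᵐ z ∂(cylMeasure Ω T), 0 ≤ φ z) →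
      ∫ z, u z ^ n * φ z ∂(cylMeasure Ω T) ≤ weakForm Ω T q vt Dv φ Dφ) ∧
    (∃ g, HasTrace Ω T p u Du g ∧ ∀ᵐ z ∂(lateralMeasure Ω T), 0 ≤ g z) ∧
    (∃ g, HasTrace Ω T q v Dv g ∧ ∀ᵐ z ∂(lateralMeasure Ω T), 0 ≤ g z) ∧
    (∃ a, HasInitialValue Ω u a ∧ ∀ᵐ x ∂(volume.restrict Ω), u₀ x ≤ a x) ∧
    (∃ a, HasInitialValue Ω v a ∧ ∀ᵐ x ∂(volume.restrict Ω), v₀ x ≤ a x)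

/-- `w` is (essentially) bounded in `Q_T`. -/
def IsBoundedOn (Ω : Set (Space N)) (T : ℝ) (w : SpaceTime N → ℝ) : Prop :=
  MemLp w ∞ (cylMeasure Ω T)

end FastDiffusion

end

/-!
The difference `w` of a subsolution and a supersolution is tested with `e^{-Kt}` times a smoothed
positive part of `w`, which has zero trace. Monotonicity of `ξ ↦ |ξ|^{p-2} ξ` makes the diffusion
terms nonnegative, and since `w⁺` vanishes at `t = 0`, integrating the time derivative by parts
leaves `(K/2) ∬ e^{-Kt} (w⁺)²`, bounded by the contribution of the sources. On the relevant range
`s ↦ s^m` is one-sided Lipschitz, because `m ≥ 1` or because the larger solution stays away from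
`0`, so the sources are bounded by the positive part of the difference of the other components. For
`K` larger than the sum of the two Lipschitz constants, the two resulting estimates force both
positive parts to vanish.

Integration by parts in time needs no density theorem: a function with weak time derivative in
`L²` agrees almost everywhere with its initial value plus the time integral of that derivative (du
Bois-Reymond), and so is absolutely continuous on almost every time line.
-/

noncomputable section

namespace FastDiffusion

variable {N : ℕ}

/-! ### A smooth approximation of the positive part -/

/-- A smooth, nondecreasing, `1`-Lipschitz approximation of the positive part, within `ε` of it. -/
def softPos (ε s : ℝ) : ℝ := ∫ r in (0 : ℝ)..s, Real.smoothTransition (r / ε)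

/-- The primitive of `softPos ε` vanishing at `0`, approximating `s ↦ s₊² / 2`. -/
def softPosPrim (ε s : ℝ) : ℝ := ∫ r in (0 : ℝ)..s, softPos ε r

section SoftPos

variable {ε : ℝ}

lemma continuous_smoothTransition_div (ε : ℝ) :
    Continuous fun r : ℝ => Real.smoothTransition (r / ε) :=
  Real.smoothTransition.continuous.comp (continuous_id.div_const ε)

lemma abs_smoothTransition_le_one (s : ℝ) : |Real.smoothTransition s| ≤ 1 := by
  rw [abs_of_nonneg (Real.smoothTransition.nonneg s)]
  exact Real.smoothTransition.le_one s

lemma hasDerivAt_softPos (ε s : ℝ) :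
    HasDerivAt (softPos ε) (Real.smoothTransition (s / ε)) s :=
  ((continuous_smoothTransition_div ε).integral_hasStrictDerivAt 0 s).hasDerivAt

lemma deriv_softPos (ε : ℝ) : deriv (softPos ε) = fun s => Real.smoothTransition (s / ε) :=
  funext fun s => (hasDerivAt_softPos ε s).deriv

lemma contDiff_softPos (ε : ℝ) : ContDiff ℝ ∞ (softPos ε) := by
  rw [contDiff_infty_iff_deriv, deriv_softPos]
  exact ⟨fun s => (hasDerivAt_softPos ε s).differentiableAt,
    Real.smoothTransition.contDiff.comp (contDiff_id.div_const ε)⟩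

lemma continuous_softPos (ε : ℝ) : Continuous (softPos ε) := (contDiff_softPos ε).continuous

lemma monotone_softPos (ε : ℝ) : Monotone (softPos ε) :=
  monotone_of_deriv_nonneg (fun s => (hasDerivAt_softPos ε s).differentiableAt)
    fun _ => deriv_softPos ε ▸ Real.smoothTransition.nonneg _

lemma softPos_zero (ε : ℝ) : softPos ε 0 = 0 := intervalIntegral.integral_same

lemma softPos_of_nonpos (hε : 0 < ε) {s : ℝ} (hs : s ≤ 0) : softPos ε s = 0 := by
  have h : EqOn (fun r => Real.smoothTransition (r / ε)) (fun _ => 0) (uIcc 0 s) := fun r hr =>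
    Real.smoothTransition.zero_of_nonpos
      (div_nonpos_of_nonpos_of_nonneg (uIcc_of_ge hs ▸ hr).2 hε.le)
  rw [softPos, intervalIntegral.integral_congr h, intervalIntegral.integral_zero]

lemma softPos_nonneg (hε : 0 < ε) (s : ℝ) : 0 ≤ softPos ε s :=
  (softPos_of_nonpos hε (min_le_right s 0)).symm.le.trans (monotone_softPos ε (min_le_left s 0))

lemma abs_softPos_sub_softPos_le (ε a b : ℝ) : |softPos ε a - softPos ε b| ≤ |a - b| := by
  simpa using convex_univ.norm_image_sub_le_of_norm_hasDerivWithin_le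
    (fun s _ => (hasDerivAt_softPos ε s).hasDerivWithinAt)
    (fun s _ => abs_smoothTransition_le_one (s / ε)) (mem_univ b) (mem_univ a)

lemma abs_softPos_le_abs (ε s : ℝ) : |softPos ε s| ≤ |s| := by
  simpa [softPos_zero] using abs_softPos_sub_softPos_le ε s 0

lemma softPos_le_posPart (ε s : ℝ) : softPos ε s ≤ max s 0 :=
  calc softPos ε s ≤ softPos ε (max s 0) := monotone_softPos ε (le_max_left s 0)
    _ ≤ |max s 0| := (le_abs_self _).trans (abs_softPos_le_abs ε _)
    _ = max s 0 := abs_of_nonneg (le_max_right s 0)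

lemma sub_le_softPos (hε : 0 < ε) (s : ℝ) : s - ε ≤ softPos ε s := by
  rcases le_total s ε with hs | hs
  · exact (sub_nonpos.2 hs).trans (softPos_nonneg hε s)
  · have slope : 1 * (s - ε) ≤ softPos ε s - softPos ε ε :=
      (convex_Ici ε).mul_sub_le_image_sub_of_le_deriv (continuous_softPos ε).continuousOn
        (fun r _ => (hasDerivAt_softPos ε r).differentiableAt.differentiableWithinAt)
        (fun r hr => by
          rw [interior_Ici, mem_Ioi] at hr
          exact (Real.smoothTransition.one_of_one_le ((one_le_div hε).2 hr.le)).symm.trans_le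
            (congrFun (deriv_softPos ε) r).ge)
        ε self_mem_Ici s hs hs
    linarith [softPos_nonneg hε ε]

lemma abs_softPos_sub_posPart_le (hε : 0 < ε) (s : ℝ) : |softPos ε s - max s 0| ≤ ε := by
  have lower : max s 0 ≤ softPos ε s + ε :=
    max_le (by linarith [sub_le_softPos hε s]) (by linarith [softPos_nonneg hε s])
  exact abs_le.2 ⟨by linarith, by linarith [softPos_le_posPart ε s]⟩

lemma tendsto_softPos (s : ℝ) : Tendsto (fun ε => softPos ε s) (𝓝[>] 0) (𝓝 (max s 0)) := by
  refine tendsto_iff_dist_tendsto_zero.2 <| squeeze_zero'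
    (Eventually.of_forall fun _ => dist_nonneg) ?_ (tendsto_nhdsWithin_of_tendsto_nhds tendsto_id)
  filter_upwards [self_mem_nhdsWithin] with ε hε using abs_softPos_sub_posPart_le hε s

lemma hasDerivAt_softPosPrim (ε s : ℝ) : HasDerivAt (softPosPrim ε) (softPos ε s) s :=
  ((continuous_softPos ε).integral_hasStrictDerivAt 0 s).hasDerivAt

lemma contDiff_softPosPrim (ε : ℝ) : ContDiff ℝ 1 (softPosPrim ε) := by
  rw [contDiff_one_iff_deriv, funext fun s => (hasDerivAt_softPosPrim ε s).deriv]
  exact ⟨fun s => (hasDerivAt_softPosPrim ε s).differentiableAt, continuous_softPos ε⟩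

lemma softPosPrim_of_nonpos (hε : 0 < ε) {s : ℝ} (hs : s ≤ 0) : softPosPrim ε s = 0 := by
  have h : EqOn (softPos ε) (fun _ => 0) (uIcc 0 s) := fun r hr =>
    softPos_of_nonpos hε (uIcc_of_ge hs ▸ hr).2
  rw [softPosPrim, intervalIntegral.integral_congr h, intervalIntegral.integral_zero]

lemma sq_softPos_div_two_le_softPosPrim (hε : 0 < ε) (s : ℝ) :
    softPos ε s ^ 2 / 2 ≤ softPosPrim ε s := by
  have hasDerivAt_diff (r : ℝ) : HasDerivAt (fun s => softPosPrim ε s - softPos ε s ^ 2 / 2)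
      (softPos ε r * (1 - Real.smoothTransition (r / ε))) r :=
    ((hasDerivAt_softPosPrim ε r).sub
      (((hasDerivAt_softPos ε r).pow 2).div_const 2)).congr_deriv (by simp; ring)
  have monotone_diff : Monotone fun s => softPosPrim ε s - softPos ε s ^ 2 / 2 :=
    monotone_of_deriv_nonneg (fun r => (hasDerivAt_diff r).differentiableAt) fun r => by
      rw [(hasDerivAt_diff r).deriv]
      exact mul_nonneg (softPos_nonneg hε r) (sub_nonneg.2 (Real.smoothTransition.le_one _))
  have h := monotone_diff (min_le_left s 0)
  simp only [softPosPrim_of_nonpos hε (min_le_right s 0),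
    softPos_of_nonpos hε (min_le_right s 0)] at h
  linarith

lemma softPosPrim_nonneg (hε : 0 < ε) (s : ℝ) : 0 ≤ softPosPrim ε s :=
  (by positivity : 0 ≤ softPos ε s ^ 2 / 2).trans (sq_softPos_div_two_le_softPosPrim hε s)

end SoftPos

/-! ### Pointwise inequalities -/

section PLaplace

variable {E : Type*} [NormedAddCommGroup E] [InnerProductSpace ℝ E] {p : ℝ}

lemma rpow_sub_two_mul_self {x : ℝ} (hx : 0 ≤ x) (hp : p ≠ 1) : x ^ (p - 2) * x = x ^ (p - 1) := by
  rw [← Real.rpow_add_one' hx (by contrapose! hp; linarith)]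
  ring_nf

lemma rpow_sub_one_mul_self {x : ℝ} (hx : 0 ≤ x) (hp : p ≠ 0) : x ^ (p - 1) * x = x ^ p := by
  rw [← Real.rpow_add_one' hx (by simpa using hp), sub_add_cancel]

lemma inner_pLaplace_sub_nonneg (hp : 1 < p) (a b : E) :
    0 ≤ ‖a‖ ^ (p - 2) * inner ℝ a (a - b) - ‖b‖ ^ (p - 2) * inner ℝ b (a - b) := by
  have norms_monotone : 0 ≤ (‖a‖ ^ (p - 1) - ‖b‖ ^ (p - 1)) * (‖a‖ - ‖b‖) := by
    have hmono := Real.monotoneOn_rpow_Ici_of_exponent_nonneg (sub_nonneg.2 hp.le)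
    rcases le_total ‖a‖ ‖b‖ with h | h
    · exact mul_nonneg_of_nonpos_of_nonpos
        (sub_nonpos.2 (hmono (norm_nonneg a) (norm_nonneg b) h)) (sub_nonpos.2 h)
    · exact mul_nonneg
        (sub_nonneg.2 (hmono (norm_nonneg b) (norm_nonneg a) h)) (sub_nonneg.2 h)
  have cauchy_a := mul_le_mul_of_nonneg_left (real_inner_le_norm a b)
    (Real.rpow_nonneg (norm_nonneg a) (p - 2))
  have cauchy_b := mul_le_mul_of_nonneg_left (real_inner_le_norm a b)
    (Real.rpow_nonneg (norm_nonneg b) (p - 2))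
  rw [← rpow_sub_two_mul_self (norm_nonneg a) hp.ne',
    ← rpow_sub_two_mul_self (norm_nonneg b) hp.ne'] at norms_monotone
  rw [inner_sub_right, inner_sub_right, real_inner_self_eq_norm_sq, real_inner_self_eq_norm_sq,
    real_inner_comm a b]
  linarith

lemma abs_pLaplace_inner_le (hp : 1 < p) (a b : E) :
    |‖a‖ ^ (p - 2) * inner ℝ a b| ≤ ‖a‖ ^ p + ‖b‖ ^ p := by
  have hM : 0 ≤ max ‖a‖ ‖b‖ := le_max_of_le_left (norm_nonneg a)
  calc |‖a‖ ^ (p - 2) * inner ℝ a b| ≤ ‖a‖ ^ (p - 2) * (‖a‖ * ‖b‖) := by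
        rw [abs_mul, abs_of_nonneg (by positivity)]
        gcongr
        exact abs_real_inner_le_norm a b
    _ = ‖a‖ ^ (p - 1) * ‖b‖ := by rw [← mul_assoc, rpow_sub_two_mul_self (norm_nonneg a) hp.ne']
    _ ≤ max ‖a‖ ‖b‖ ^ (p - 1) * max ‖a‖ ‖b‖ := by
        gcongr
        exacts [le_max_left _ _, le_max_right _ _]
    _ = max ‖a‖ ‖b‖ ^ p := rpow_sub_one_mul_self hM (by linarith)
    _ ≤ ‖a‖ ^ p + ‖b‖ ^ p := by
        rcases max_choice ‖a‖ ‖b‖ with h | h <;> rw [h] <;>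
          simp only [le_add_iff_nonneg_right, le_add_iff_nonneg_left] <;> positivity

lemma integrable_pLaplace_inner {α : Type*} [MeasurableSpace α] {μ : Measure α} (hp : 1 < p)
    {a b : α → E} (ha : MemLp a (ENNReal.ofReal p) μ) (hb : MemLp b (ENNReal.ofReal p) μ) :
    Integrable (fun z => ‖a z‖ ^ (p - 2) * inner ℝ (a z) (b z)) μ := by
  have hp0 : 0 < p := one_pos.trans hp
  have integrable_rpow {c : α → E} (hc : MemLp c (ENNReal.ofReal p) μ) :
      Integrable (fun z => ‖c z‖ ^ p) μ := by
    simpa [ENNReal.toReal_ofReal hp0.le] using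
      hc.integrable_norm_rpow (by simpa using hp0) ENNReal.ofReal_ne_top
  refine ((integrable_rpow ha).add (integrable_rpow hb)).mono' ?_
    (Eventually.of_forall fun z => abs_pLaplace_inner_le hp (a z) (b z))
  exact (ha.1.norm.aemeasurable.pow_const _).aestronglyMeasurable.mul (ha.1.inner hb.1)

end PLaplace

section Source

variable {α : Type*} [MeasurableSpace α] {μ : Measure α} {m : ℝ} {v v₁ v₂ : α → ℝ}

lemma rpow_sub_rpow_le {a b L : ℝ} (hb : 0 ≤ b) (hm : 0 < m) (hba : b ≤ a)
    (hL : ∀ x ∈ Ioo b a, m * x ^ (m - 1) ≤ L) : a ^ m - b ^ m ≤ L * (a - b) := by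
  have hasDerivAt {x : ℝ} (hx : x ∈ Ioo b a) : HasDerivAt (· ^ m) (m * x ^ (m - 1)) x :=
    Real.hasDerivAt_rpow_const (Or.inl (hb.trans_lt hx.1).ne')
  refine (convex_Icc b a).image_sub_le_mul_sub_of_deriv_le
    (Real.continuous_rpow_const hm.le).continuousOn (fun x hx => ?_) (fun x hx => ?_)
    b (left_mem_Icc.2 hba) a (right_mem_Icc.2 hba) hba <;> rw [interior_Icc] at hx
  · exact (hasDerivAt hx).differentiableAt.differentiableWithinAt
  · exact (hasDerivAt hx).deriv.trans_le (hL x hx)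

lemma exists_rpow_sub_rpow_le (hm : 0 < m) {δ : ℝ} (hδ : 0 ≤ δ) (h : 1 ≤ m ∨ 0 < δ) (M : ℝ) :
    ∃ L, 0 ≤ L ∧ ∀ a b : ℝ, 0 ≤ a → a ≤ M → δ ≤ b → a ^ m - b ^ m ≤ L * max (a - b) 0 := by
  obtain ⟨L, hL0, hL⟩ : ∃ L, 0 ≤ L ∧ ∀ x, δ < x → x < M → m * x ^ (m - 1) ≤ L := by
    rcases le_or_gt 1 m with hm1 | hm1
    · refine ⟨m * |M| ^ (m - 1), by positivity, fun x hx hxM => ?_⟩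
      gcongr
      exacts [hδ.trans hx.le, hxM.le.trans (le_abs_self M)]
    · refine ⟨m * δ ^ (m - 1), by positivity, fun x hx _ => ?_⟩
      exact mul_le_mul_of_nonneg_left (Real.rpow_le_rpow_of_nonpos
        (h.resolve_left hm1.not_ge) hx.le (sub_nonpos.2 hm1.le)) hm.le
  refine ⟨L, hL0, fun a b ha haM hb => ?_⟩
  rcases le_total a b with hab | hab
  · rw [max_eq_right (sub_nonpos.2 hab), mul_zero]
    exact sub_nonpos.2 (Real.rpow_le_rpow ha hab hm.le)
  · rw [max_eq_left (sub_nonneg.2 hab)]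
    exact rpow_sub_rpow_le (hδ.trans hb) hm hab fun x hx =>
      hL x (hb.trans_lt hx.1) (hx.2.trans_le haM)

lemma exists_ae_rpow_sub_rpow_le (hm : 0 < m) (hv₁ : MemLp v₁ ∞ μ) (h₁ : ∀ᵐ z ∂μ, 0 ≤ v₁ z)
    (h₂ : ∀ᵐ z ∂μ, 0 ≤ v₂ z) (h : 1 ≤ m ∨ ∃ δ > 0, ∀ᵐ z ∂μ, δ ≤ v₂ z) :
    ∃ L, 0 ≤ L ∧ ∀ᵐ z ∂μ, v₁ z ^ m - v₂ z ^ m ≤ L * max (v₁ z - v₂ z) 0 := by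
  obtain ⟨δ, hδ, hδm, hv₂⟩ : ∃ δ, 0 ≤ δ ∧ (1 ≤ m ∨ 0 < δ) ∧ ∀ᵐ z ∂μ, δ ≤ v₂ z := by
    rcases h with h | ⟨δ, hδ, h⟩
    exacts [⟨0, le_rfl, Or.inl h, h₂⟩, ⟨δ, hδ.le, Or.inr hδ, h⟩]
  obtain ⟨L, hL, hlip⟩ := exists_rpow_sub_rpow_le hm hδ hδm (eLpNorm v₁ ∞ μ).toReal
  refine ⟨L, hL, ?_⟩
  filter_upwards [h₁, hv₂, enorm_ae_le_eLpNormEssSup v₁ μ] with z hz₁ hz₂ hz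
  refine hlip _ _ hz₁ ((le_abs_self _).trans ?_) hz₂
  rw [eLpNorm_exponent_top, ← Real.norm_eq_abs, ← toReal_enorm]
  exact ENNReal.toReal_mono (eLpNorm_exponent_top (f := v₁) ▸ hv₁.2.ne) hz

lemma memLp_two_rpow (hm : 0 < m) (hv : MemLp v (ENNReal.ofReal (2 * m)) μ)
    (hv₀ : ∀ᵐ z ∂μ, 0 ≤ v z) : MemLp (fun z => v z ^ m) 2 μ := by
  have h := hv.norm_rpow_div (ENNReal.ofReal m)
  rw [ENNReal.toReal_ofReal hm.le, ← ENNReal.ofReal_div_of_pos hm, mul_div_cancel_right₀ _ hm.ne',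
    ENNReal.ofReal_ofNat] at h
  refine h.ae_eq (hv₀.mono fun z hz => ?_)
  simp only [Real.norm_of_nonneg hz]

end Source

/-! ### Convergence in `L^p` -/

section LpConvergence

variable {α ι E F : Type*} [MeasurableSpace α] {μ : Measure α} [NormedAddCommGroup E]
  [NormedAddCommGroup F] {l : Filter ι} {P : ℝ≥0∞}

lemma tendsto_eLpNorm_zero_of_le {f : ι → α → E} {g : ι → α → F} {C : ℝ}
    (hfg : ∀ k, ∀ᵐ z ∂μ, ‖f k z‖ ≤ C * ‖g k z‖)
    (hg : Tendsto (fun k => eLpNorm (g k) P μ) l (𝓝 0)) :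
    Tendsto (fun k => eLpNorm (f k) P μ) l (𝓝 0) := by
  have hbound : Tendsto (fun k => ENNReal.ofReal C * eLpNorm (g k) P μ) l (𝓝 0) := by
    simpa using ENNReal.Tendsto.const_mul hg (Or.inr ENNReal.ofReal_ne_top)
  exact tendsto_of_tendsto_of_tendsto_of_le_of_le tendsto_const_nhds hbound (fun _ => zero_le)
    fun k => eLpNorm_le_mul_eLpNorm_of_ae_le_mul (hfg k) P

lemma tendsto_eLpNorm_sub_zero (hP : 1 ≤ P) {f g : ι → α → E}
    (hfm : ∀ k, AEStronglyMeasurable (f k) μ) (hgm : ∀ k, AEStronglyMeasurable (g k) μ)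
    (hf : Tendsto (fun k => eLpNorm (f k) P μ) l (𝓝 0))
    (hg : Tendsto (fun k => eLpNorm (g k) P μ) l (𝓝 0)) :
    Tendsto (fun k => eLpNorm (f k - g k) P μ) l (𝓝 0) :=
  tendsto_of_tendsto_of_tendsto_of_le_of_le tendsto_const_nhds (by simpa using hf.add hg)
    (fun _ => zero_le) fun k => eLpNorm_sub_le (hfm k) (hgm k) hP

lemma tendsto_eLpNorm_smul_zero [NormedSpace ℝ E] (hP : P ≠ 0) (hP' : P ≠ ⊤) {G : α → E}
    (hG : MemLp G P μ) {h : ℕ → α → ℝ} (hh : ∀ k, AEStronglyMeasurable (h k) μ) {C : ℝ}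
    (hC : ∀ k, ∀ᵐ z ∂μ, |h k z| ≤ C) (hlim : ∀ᵐ z ∂μ, Tendsto (h · z) atTop (𝓝 0)) :
    Tendsto (fun k => eLpNorm (h k • G) P μ) atTop (𝓝 0) := by
  have hPr : 0 < P.toReal := ENNReal.toReal_pos hP hP'
  have lintegral_tendsto :
      Tendsto (fun k => ∫⁻ z, ‖h k z • G z‖ₑ ^ P.toReal ∂μ) atTop (𝓝 0) := by
    rw [← lintegral_zero (μ := μ)]
    refine tendsto_lintegral_of_dominated_convergence' (fun z => ‖C • G z‖ₑ ^ P.toReal)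
      (fun k => ((hh k).smul hG.1).enorm.pow_const _) (fun k => ?_)
      (lintegral_rpow_enorm_lt_top_of_eLpNorm_lt_top hP hP' (hG.const_smul C).2).ne ?_
    · filter_upwards [hC k] with z hz
      gcongr
      rw [enorm_le_iff_norm_le, norm_smul, norm_smul]
      gcongr
      exact hz.trans (le_abs_self C)
    · filter_upwards [hlim] with z hz
      simpa [ENNReal.zero_rpow_of_pos hPr] using (hz.smul_const (G z)).enorm.ennrpow_const P.toReal
  simp_rw [eLpNorm_eq_lintegral_rpow_enorm_toReal hP hP']
  simpa [ENNReal.zero_rpow_of_pos (inv_pos.2 hPr)] using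
    lintegral_tendsto.ennrpow_const (1 / P.toReal)

lemma tendsto_eLpNorm_smul_sub_smul [NormedSpace ℝ E] (hP : 1 ≤ P) (hP' : P ≠ ⊤)
    {G : α → E} {Gs : ℕ → α → E} (hG : MemLp G P μ) (hGs : ∀ k, AEStronglyMeasurable (Gs k) μ)
    {h : α → ℝ} {hs : ℕ → α → ℝ} (hh : AEStronglyMeasurable h μ)
    (hhs : ∀ k, AEStronglyMeasurable (hs k) μ) {C : ℝ} (hC : ∀ᵐ z ∂μ, |h z| ≤ C)
    (hCs : ∀ k, ∀ᵐ z ∂μ, |hs k z| ≤ C)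
    (hlim : ∀ᵐ z ∂μ, Tendsto (hs · z) atTop (𝓝 (h z)))
    (hGlim : Tendsto (fun k => eLpNorm (Gs k - G) P μ) atTop (𝓝 0)) :
    Tendsto (fun k => eLpNorm (hs k • Gs k - h • G) P μ) atTop (𝓝 0) := by
  have fields : Tendsto (fun k => eLpNorm (hs k • (Gs k - G)) P μ) atTop (𝓝 0) := by
    refine tendsto_eLpNorm_zero_of_le (C := C) (fun k => (hCs k).mono fun z hz => ?_) hGlim
    rw [Pi.smul_apply', norm_smul]
    exact mul_le_mul_of_nonneg_right hz (norm_nonneg _)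
  have multipliers : Tendsto (fun k => eLpNorm ((h - hs k) • G) P μ) atTop (𝓝 0) := by
    refine tendsto_eLpNorm_smul_zero (one_pos.trans_le hP).ne' hP' hG (C := C + C)
      (fun k => hh.sub (hhs k)) (fun k => ?_) (hlim.mono fun z hz => ?_)
    · filter_upwards [hC, hCs k] with z hz hzs using (abs_sub _ _).trans (add_le_add hz hzs)
    · simpa using hz.const_sub (h z)
  refine (tendsto_eLpNorm_sub_zero hP (fun k => (hhs k).smul ((hGs k).sub hG.1))
    (fun k => (hh.sub (hhs k)).smul hG.1) fields multipliers).congr fun k => ?_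
  rw [smul_sub, sub_smul, sub_sub_sub_cancel_right]

lemma tendsto_integral_mul_of_tendsto_eLpNorm {Q : ℝ≥0∞} [P.HolderConjugate Q]
    {f : ι → α → ℝ} {g ψ : α → ℝ} (hf : ∀ k, AEStronglyMeasurable (f k) μ)
    (hg : AEStronglyMeasurable g μ) (hψ : MemLp ψ Q μ)
    (hfψ : ∀ k, Integrable (fun z => f k z * ψ z) μ)
    (hfg : Tendsto (fun k => eLpNorm (f k - g) P μ) l (𝓝 0)) :
    Tendsto (fun k => ∫ z, f k z * ψ z ∂μ) l (𝓝 (∫ z, g z * ψ z ∂μ)) := by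
  refine tendsto_integral_of_L1' _ (hg.mul hψ.1) (Eventually.of_forall hfψ) ?_
  have hbound : Tendsto (fun k => eLpNorm (f k - g) P μ * eLpNorm ψ Q μ) l (𝓝 0) := by
    simpa using ENNReal.Tendsto.mul_const hfg (Or.inr hψ.2.ne)
  refine tendsto_of_tendsto_of_tendsto_of_le_of_le tendsto_const_nhds hbound (fun _ => zero_le)
    fun k => ?_
  calc eLpNorm (f k * ψ - g * ψ) 1 μ = eLpNorm ((f k - g) • ψ) 1 μ := by
        rw [← sub_mul, smul_eq_mul]
    _ ≤ eLpNorm (f k - g) P μ * eLpNorm ψ Q μ :=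
        eLpNorm_smul_le_mul_eLpNorm hψ.1 ((hf k).sub hg)

end LpConvergence

/-! ### Weak derivatives and traces on the cylinder -/

instance : (volume : Measure (SpaceTime N)).IsAddHaarMeasure :=
  inferInstanceAs (Measure.prod volume volume).IsAddHaarMeasure

section SpatialGrad

variable {φ ψ : SpaceTime N → ℝ} {z : SpaceTime N}

lemma spatialGrad_apply (hφ : DifferentiableAt ℝ φ z) (i : Fin N) :
    spatialGrad φ z i = fderiv ℝ φ z (EuclideanSpace.single i 1, 0) := by
  have hslice : HasFDerivAt (fun x => φ (x, z.2))
      ((fderiv ℝ φ z).comp (ContinuousLinearMap.inl ℝ (Space N) ℝ)) z.1 :=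
    HasFDerivAt.comp z.1 (f := fun x => (x, z.2)) hφ.hasFDerivAt (hasFDerivAt_prodMk_left z.1 z.2)
  have hinner : inner ℝ (spatialGrad φ z) (EuclideanSpace.single i (1 : ℝ)) =
      fderiv ℝ φ z (EuclideanSpace.single i 1, 0) := by
    rw [spatialGrad, gradient, InnerProductSpace.toDual_symm_apply, hslice.fderiv]
    rfl
  simpa [EuclideanSpace.inner_single_right] using hinner

lemma continuous_spatialGrad (hφ : ContDiff ℝ ∞ φ) : Continuous (spatialGrad φ) := by
  have h : spatialGrad φ = fun z => WithLp.toLp 2 fun i : Fin N =>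
      fderiv ℝ φ z (EuclideanSpace.single i 1, 0) := by
    ext z i
    exact spatialGrad_apply (hφ.differentiable (by simp) z) i
  have := hφ.continuous_fderiv (by simp)
  rw [h]
  fun_prop

lemma spatialGrad_sub (hφ : DifferentiableAt ℝ φ z) (hψ : DifferentiableAt ℝ ψ z) :
    spatialGrad (φ - ψ) z = spatialGrad φ z - spatialGrad ψ z := by
  ext i
  rw [PiLp.sub_apply, spatialGrad_apply hφ, spatialGrad_apply hψ, spatialGrad_apply (hφ.sub hψ),
    fderiv_sub hφ hψ, sub_apply]

lemma spatialGrad_comp {Φ : ℝ → ℝ} (hΦ : DifferentiableAt ℝ Φ (φ z))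
    (hφ : DifferentiableAt ℝ φ z) :
    spatialGrad (Φ ∘ φ) z = deriv Φ (φ z) • spatialGrad φ z := by
  ext i
  have h := hΦ.hasDerivAt.comp_hasFDerivAt z hφ.hasFDerivAt
  rw [PiLp.smul_apply, spatialGrad_apply hφ, spatialGrad_apply h.differentiableAt, h.fderiv]
  rfl

lemma spatialGrad_time_mul {η : ℝ → ℝ} (hη : DifferentiableAt ℝ η z.2)
    (hφ : DifferentiableAt ℝ φ z) :
    spatialGrad (fun z => η z.2 * φ z) z = η z.2 • spatialGrad φ z := by
  ext i
  have h : HasFDerivAt (fun z => η z.2 * φ z) _ z :=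
    (hη.hasDerivAt.comp_hasFDerivAt z hasFDerivAt_snd).mul hφ.hasFDerivAt
  rw [PiLp.smul_apply, spatialGrad_apply hφ, spatialGrad_apply h.differentiableAt, h.fderiv]
  simp

end SpatialGrad

variable {Ω : Set (Space N)} {T p : ℝ}

section Cylinder

lemma cylMeasure_eq_prod (Ω : Set (Space N)) (T : ℝ) :
    cylMeasure Ω T = (volume.restrict Ω).prod (volume.restrict (Ioo 0 T)) := by
  rw [Measure.prod_restrict, cylMeasure, cylinder, Measure.volume_eq_prod]

lemma isOpen_cylinder (hΩ : IsOpen Ω) (T : ℝ) : IsOpen (cylinder Ω T) := hΩ.prod isOpen_Ioo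

lemma ae_time_mem_Ioo_cylMeasure (Ω : Set (Space N)) (T : ℝ) :
    ∀ᵐ z ∂cylMeasure Ω T, z.2 ∈ Ioo 0 T := by
  rw [cylMeasure_eq_prod]
  exact Measure.quasiMeasurePreserving_snd.ae (ae_restrict_mem measurableSet_Ioo)

lemma ae_time_mem_Ioo_lateralMeasure (Ω : Set (Space N)) (T : ℝ) :
    ∀ᵐ z ∂lateralMeasure Ω T, z.2 ∈ Ioo 0 T :=
  Measure.quasiMeasurePreserving_snd.ae (ae_restrict_mem measurableSet_Ioo)

lemma exists_abs_le_of_mem_Ioo {η : ℝ → ℝ} (hη : Continuous η) (T : ℝ) :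
    ∃ C, ∀ t ∈ Ioo 0 T, |η t| ≤ C :=
  (isCompact_Icc.exists_bound_of_continuousOn hη.continuousOn).imp fun _ hC t ht =>
    hC t (Ioo_subset_Icc_self ht)

lemma memLp_time_smul {E : Type*} [NormedAddCommGroup E] [NormedSpace ℝ E] {P : ℝ≥0∞}
    {f : SpaceTime N → E} {η : ℝ → ℝ} (hη : Continuous η) (hf : MemLp f P (cylMeasure Ω T)) :
    MemLp (fun z => η z.2 • f z) P (cylMeasure Ω T) := by
  obtain ⟨C, hC⟩ := exists_abs_le_of_mem_Ioo hη T
  refine hf.of_le_mul (c := C) ((hη.comp continuous_snd).aestronglyMeasurable.smul hf.1) ?_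
  filter_upwards [ae_time_mem_Ioo_cylMeasure Ω T] with z hz
  rw [norm_smul]
  exact mul_le_mul_of_nonneg_right (hC _ hz) (norm_nonneg _)

lemma integrable_time_mul {f : SpaceTime N → ℝ} {η : ℝ → ℝ} (hη : Continuous η)
    (hf : Integrable f (cylMeasure Ω T)) : Integrable (fun z => η z.2 * f z) (cylMeasure Ω T) :=
  memLp_one_iff_integrable.1 (memLp_time_smul hη (memLp_one_iff_integrable.2 hf))

lemma integral_mul_cylMeasure_of_tsupport_subset (f : SpaceTime N → ℝ) {ψ : SpaceTime N → ℝ}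
    (hψ : tsupport ψ ⊆ cylinder Ω T) :
    ∫ z, f z * ψ z ∂cylMeasure Ω T = ∫ z, f z * ψ z :=
  setIntegral_eq_integral_of_forall_compl_eq_zero fun z hz => by
    rw [image_eq_zero_of_notMem_tsupport fun h => hz (hψ h), mul_zero]

end Cylinder

section WeakDeriv

variable {d : SpaceTime N} {w w₁ w₂ g g₁ g₂ φ : SpaceTime N → ℝ}

lemma hasWeakDeriv_of_contDiff (hφ : ContDiff ℝ ∞ φ) (Ω : Set (Space N)) (T : ℝ)
    (d : SpaceTime N) : HasWeakDeriv Ω T d φ (fun z => fderiv ℝ φ z d) := by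
  intro ψ hψ hψc hψs
  have hφd : Continuous fun z => fderiv ℝ φ z d :=
    (hφ.continuous_fderiv (by simp)).clm_apply continuous_const
  have hψd : Continuous fun z => fderiv ℝ ψ z d :=
    (hψ.continuous_fderiv (by simp)).clm_apply continuous_const
  rw [integral_mul_cylMeasure_of_tsupport_subset _ hψs, integral_mul_cylMeasure_of_tsupport_subset
    _ ((tsupport_fderiv_apply_subset ℝ d).trans hψs)]
  exact integral_mul_fderiv_eq_neg_fderiv_mul_of_integrable
    ((hφd.mul hψ.continuous).integrable_of_hasCompactSupport hψc.mul_left)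
    ((hφ.continuous.mul hψd).integrable_of_hasCompactSupport (hψc.fderiv_apply ℝ d).mul_left)
    ((hφ.continuous.mul hψ.continuous).integrable_of_hasCompactSupport hψc.mul_left)
    (fun z _ => hφ.differentiable (by simp) z) (fun z _ => hψ.differentiable (by simp) z)

lemma hasWeakDeriv_of_tendsto {P : ℝ≥0∞} (hP : 1 ≤ P) {φ : ℕ → SpaceTime N → ℝ}
    (hφ : ∀ k, ContDiff ℝ ∞ (φ k)) (hw : AEStronglyMeasurable w (cylMeasure Ω T))
    (hg : AEStronglyMeasurable g (cylMeasure Ω T))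
    (hφw : Tendsto (fun k => eLpNorm (φ k - w) P (cylMeasure Ω T)) atTop (𝓝 0))
    (hφg : Tendsto (fun k => eLpNorm ((fun z => fderiv ℝ (φ k) z d) - g) P (cylMeasure Ω T))
      atTop (𝓝 0)) :
    HasWeakDeriv Ω T d w g := by
  have := ENNReal.HolderConjugate.conjExponent hP
  intro ψ hψ hψc hψs
  have hψd : Continuous fun z => fderiv ℝ ψ z d :=
    (hψ.continuous_fderiv (by simp)).clm_apply continuous_const
  have hψdc : HasCompactSupport fun z => fderiv ℝ ψ z d := hψc.fderiv_apply ℝ d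
  have hφd (k : ℕ) : Continuous fun z => fderiv ℝ (φ k) z d :=
    ((hφ k).continuous_fderiv (by simp)).clm_apply continuous_const
  have lhs_tendsto := tendsto_integral_mul_of_tendsto_eLpNorm (P := P) (Q := P.conjExponent)
    (fun k => (hφ k).continuous.aestronglyMeasurable) hw
    ((hψd.memLp_of_hasCompactSupport hψdc).restrict _)
    (fun k => (((hφ k).continuous.mul hψd).integrable_of_hasCompactSupport
      hψdc.mul_left).restrict) hφw
  have rhs_tendsto := tendsto_integral_mul_of_tendsto_eLpNorm (P := P) (Q := P.conjExponent)
    (fun k => (hφd k).aestronglyMeasurable) hg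
    ((hψ.continuous.memLp_of_hasCompactSupport hψc).restrict _)
    (fun k => (((hφd k).mul hψ.continuous).integrable_of_hasCompactSupport
      hψc.mul_left).restrict) hφg
  exact tendsto_nhds_unique lhs_tendsto <| rhs_tendsto.neg.congr fun k =>
    (hasWeakDeriv_of_contDiff (hφ k) Ω T d ψ hψ hψc hψs).symm

lemma HasWeakDeriv.sub (h₁ : HasWeakDeriv Ω T d w₁ g₁) (h₂ : HasWeakDeriv Ω T d w₂ g₂)
    (hw₁ : LocallyIntegrable w₁ (cylMeasure Ω T)) (hw₂ : LocallyIntegrable w₂ (cylMeasure Ω T))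
    (hg₁ : LocallyIntegrable g₁ (cylMeasure Ω T)) (hg₂ : LocallyIntegrable g₂ (cylMeasure Ω T)) :
    HasWeakDeriv Ω T d (w₁ - w₂) (g₁ - g₂) := by
  intro φ hφ hφc hφs
  have hφd : Continuous fun z => fderiv ℝ φ z d :=
    (hφ.continuous_fderiv (by simp)).clm_apply continuous_const
  have integrable_mul {f ψ : SpaceTime N → ℝ} (hf : LocallyIntegrable f (cylMeasure Ω T))
      (hψ : Continuous ψ) (hψc : HasCompactSupport ψ) :
      Integrable (fun z => f z * ψ z) (cylMeasure Ω T) :=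
    hf.integrable_smul_right_of_hasCompactSupport hψ hψc
  simp only [Pi.sub_apply, sub_mul]
  rw [integral_sub (integrable_mul hw₁ hφd (hφc.fderiv_apply ℝ d))
    (integrable_mul hw₂ hφd (hφc.fderiv_apply ℝ d)),
    integral_sub (integrable_mul hg₁ hφ.continuous hφc) (integrable_mul hg₂ hφ.continuous hφc),
    h₁ φ hφ hφc hφs, h₂ φ hφ hφc hφs]
  ring

end WeakDeriv

section Trace

variable {w w₁ w₂ g g₁ g₂ : SpaceTime N → ℝ} {G G₁ G₂ : SpaceTime N → Space N}

lemma HasTrace.hasWeakGrad (h : HasTrace Ω T p w G g) (hp : 1 ≤ p)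
    (hw : AEStronglyMeasurable w (cylMeasure Ω T)) (hG : AEStronglyMeasurable G (cylMeasure Ω T)) :
    HasWeakGrad Ω T w G := by
  obtain ⟨-, φ, hφ, hφw, hφG, -⟩ := h
  intro i
  refine hasWeakDeriv_of_tendsto (ENNReal.one_le_ofReal.2 hp) hφ hw
    ((show Continuous fun x : Space N => x i by fun_prop).comp_aestronglyMeasurable hG) hφw ?_
  refine tendsto_eLpNorm_zero_of_le (C := 1) (fun k => Eventually.of_forall fun z => ?_) hφG
  rw [Pi.sub_apply, ← spatialGrad_apply ((hφ k).differentiable (by simp) z) i, one_mul]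
  exact PiLp.norm_apply_le (spatialGrad (φ k) z - G z) i

lemma HasTrace.sub (h₁ : HasTrace Ω T p w₁ G₁ g₁) (h₂ : HasTrace Ω T p w₂ G₂ g₂) (hp : 1 ≤ p)
    (hw₁ : AEStronglyMeasurable w₁ (cylMeasure Ω T))
    (hw₂ : AEStronglyMeasurable w₂ (cylMeasure Ω T))
    (hG₁ : AEStronglyMeasurable G₁ (cylMeasure Ω T))
    (hG₂ : AEStronglyMeasurable G₂ (cylMeasure Ω T)) :
    HasTrace Ω T p (w₁ - w₂) (G₁ - G₂) (g₁ - g₂) := by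
  obtain ⟨hg₁, φ₁, hφ₁, hw₁lim, hG₁lim, hg₁lim⟩ := h₁
  obtain ⟨hg₂, φ₂, hφ₂, hw₂lim, hG₂lim, hg₂lim⟩ := h₂
  have hP : 1 ≤ ENNReal.ofReal p := ENNReal.one_le_ofReal.2 hp
  have hφ₁m {μ : Measure (SpaceTime N)} (k : ℕ) : AEStronglyMeasurable (φ₁ k) μ :=
    (hφ₁ k).continuous.aestronglyMeasurable
  have hφ₂m {μ : Measure (SpaceTime N)} (k : ℕ) : AEStronglyMeasurable (φ₂ k) μ :=
    (hφ₂ k).continuous.aestronglyMeasurable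
  refine ⟨hg₁.sub hg₂, fun k => φ₁ k - φ₂ k, fun k => (hφ₁ k).sub (hφ₂ k), ?_, ?_, ?_⟩
  · refine (tendsto_eLpNorm_sub_zero hP (fun k => (hφ₁m k).sub hw₁) (fun k => (hφ₂m k).sub hw₂)
      hw₁lim hw₂lim).congr fun k => ?_
    rw [sub_sub_sub_comm]
    rfl
  · refine (tendsto_eLpNorm_sub_zero hP
      (fun k => (continuous_spatialGrad (hφ₁ k)).aestronglyMeasurable.sub hG₁)
      (fun k => (continuous_spatialGrad (hφ₂ k)).aestronglyMeasurable.sub hG₂)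
      hG₁lim hG₂lim).congr fun k => ?_
    congr 1 with z : 1
    rw [spatialGrad_sub ((hφ₁ k).differentiable (by simp) z)
      ((hφ₂ k).differentiable (by simp) z)]
    exact sub_sub_sub_comm ..
  · refine (tendsto_eLpNorm_sub_zero hP (fun k => (hφ₁m k).sub hg₁.1)
      (fun k => (hφ₂m k).sub hg₂.1) hg₁lim hg₂lim).congr fun k => ?_
    rw [sub_sub_sub_comm]
    rfl

lemma HasTrace.comp (h : HasTrace Ω T p w G g) (hp : 1 ≤ p)
    (hw : AEStronglyMeasurable w (cylMeasure Ω T))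
    (hG : MemLp G (ENNReal.ofReal p) (cylMeasure Ω T)) {Φ : ℝ → ℝ} (hΦ : ContDiff ℝ ∞ Φ)
    {C : ℝ} (hC : ∀ s, |deriv Φ s| ≤ C) (hΦ0 : Φ 0 = 0) :
    HasTrace Ω T p (Φ ∘ w) (fun z => deriv Φ (w z) • G z) (Φ ∘ g) := by
  obtain ⟨hg, φ, hφ, hφw, hφG, hφg⟩ := h
  have hP : 1 ≤ ENNReal.ofReal p := ENNReal.one_le_ofReal.2 hp
  have lipschitz (a b : ℝ) : |Φ a - Φ b| ≤ C * |a - b| :=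
    convex_univ.norm_image_sub_le_of_norm_deriv_le
      (fun s _ => hΦ.differentiable (by simp) s) (fun s _ => hC s) (mem_univ b) (mem_univ a)
  have hderiv : Continuous (deriv Φ) := hΦ.continuous_deriv (by simp)
  obtain ⟨ns, hns, hae⟩ := (tendstoInMeasure_of_tendsto_eLpNorm (one_pos.trans_le hP).ne'
    (fun k => (hφ k).continuous.aestronglyMeasurable) hw hφw).exists_seq_tendsto_ae
  have comp_tendsto {μ : Measure (SpaceTime N)} {f : SpaceTime N → ℝ}
      (hf : Tendsto (fun k => eLpNorm (fun z => φ k z - f z) (ENNReal.ofReal p) μ) atTop (𝓝 0)) :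
      Tendsto (fun k => eLpNorm (fun z => (Φ ∘ φ (ns k)) z - (Φ ∘ f) z) (ENNReal.ofReal p) μ)
        atTop (𝓝 0) :=
    tendsto_eLpNorm_zero_of_le (fun k => Eventually.of_forall fun z => lipschitz _ _)
      (hf.comp hns.tendsto_atTop)
  refine ⟨hg.of_le_mul (c := C) (hΦ.continuous.comp_aestronglyMeasurable hg.1)
    (Eventually.of_forall fun z => by simpa [hΦ0] using lipschitz (g z) 0),
    fun k => Φ ∘ φ (ns k), fun k => hΦ.comp (hφ (ns k)), comp_tendsto hφw, ?_, comp_tendsto hφg⟩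
  refine (tendsto_eLpNorm_smul_sub_smul hP ENNReal.ofReal_ne_top hG
    (fun k => (continuous_spatialGrad (hφ (ns k))).aestronglyMeasurable)
    (hderiv.comp_aestronglyMeasurable hw)
    (fun k => (hderiv.comp (hφ (ns k)).continuous).aestronglyMeasurable)
    (Eventually.of_forall fun z => hC _) (fun k => Eventually.of_forall fun z => hC _)
    (hae.mono fun z hz => (hderiv.tendsto _).comp hz) (hφG.comp hns.tendsto_atTop)).congr
    fun k => ?_
  congr 1 with z : 1
  rw [spatialGrad_comp (hΦ.differentiable (by simp) _) ((hφ (ns k)).differentiable (by simp) z)]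
  rfl

lemma HasTrace.time_mul (h : HasTrace Ω T p w G g) {η : ℝ → ℝ} (hη : ContDiff ℝ ∞ η) :
    HasTrace Ω T p (fun z => η z.2 * w z) (fun z => η z.2 • G z) (fun z => η z.2 * g z) := by
  obtain ⟨hg, φ, hφ, hφw, hφG, hφg⟩ := h
  obtain ⟨C, hC⟩ := exists_abs_le_of_mem_Ioo hη.continuous T
  have hηm {μ : Measure (SpaceTime N)} : AEStronglyMeasurable (fun z : SpaceTime N => η z.2) μ :=
    (hη.continuous.comp continuous_snd).aestronglyMeasurable
  have smul_tendsto {E : Type} [NormedAddCommGroup E] [NormedSpace ℝ E]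
      {μ : Measure (SpaceTime N)} (hμ : ∀ᵐ z ∂μ, z.2 ∈ Ioo 0 T) {f : ℕ → SpaceTime N → E}
      (hf : Tendsto (fun k => eLpNorm (f k) (ENNReal.ofReal p) μ) atTop (𝓝 0)) :
      Tendsto (fun k => eLpNorm (fun z => η z.2 • f k z) (ENNReal.ofReal p) μ) atTop (𝓝 0) :=
    tendsto_eLpNorm_zero_of_le (C := C) (fun k => hμ.mono fun z hz => by
      rw [norm_smul]; exact mul_le_mul_of_nonneg_right (hC _ hz) (norm_nonneg _)) hf
  have hlateral := ae_time_mem_Ioo_lateralMeasure Ω T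
  have hcyl := ae_time_mem_Ioo_cylMeasure Ω T
  refine ⟨hg.of_le_mul (c := C) (hηm.mul hg.1) (hlateral.mono fun z hz => by
    rw [norm_mul]; exact mul_le_mul_of_nonneg_right (hC _ hz) (norm_nonneg _)),
    fun k z => η z.2 * φ k z, fun k => (hη.comp contDiff_snd).mul (hφ k), ?_, ?_, ?_⟩
  · simpa only [smul_eq_mul, mul_sub] using smul_tendsto hcyl hφw
  · refine (smul_tendsto hcyl hφG).congr fun k => ?_
    congr 1 with z : 1
    rw [spatialGrad_time_mul (hη.differentiable (by simp) _)
      ((hφ k).differentiable (by simp) z), smul_sub]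
  · simpa only [smul_eq_mul, mul_sub] using smul_tendsto hlateral hφg

lemma HasTrace.congr_trace (h : HasTrace Ω T p w G g₁) (hg : g₁ =ᵐ[lateralMeasure Ω T] g₂) :
    HasTrace Ω T p w G g₂ := by
  obtain ⟨hg₁, φ, hφ, hφw, hφG, hφg⟩ := h
  refine ⟨hg₁.ae_eq hg, φ, hφ, hφw, hφG, hφg.congr fun k => eLpNorm_congr_ae ?_⟩
  filter_upwards [hg] with z hz
  rw [hz]

lemma memLp_softPos {α : Type*} [MeasurableSpace α] {μ : Measure α} {P : ℝ≥0∞} {w : α → ℝ}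
    (hw : MemLp w P μ) (ε : ℝ) : MemLp (fun z => softPos ε (w z)) P μ :=
  hw.of_le ((continuous_softPos ε).comp_aestronglyMeasurable hw.1)
    (Eventually.of_forall fun z => abs_softPos_le_abs ε (w z))

lemma HasTrace.memEZero_time_mul_softPos (h : HasTrace Ω T p w G g) (hp : 1 ≤ p)
    (hw : MemLp w 2 (cylMeasure Ω T)) (hG : MemLp G (ENNReal.ofReal p) (cylMeasure Ω T))
    (hg : ∀ᵐ z ∂lateralMeasure Ω T, g z ≤ 0) {η : ℝ → ℝ} (hη : ContDiff ℝ ∞ η)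
    {ε : ℝ} (hε : 0 < ε) :
    MemEZero Ω T p (fun z => η z.2 * softPos ε (w z))
      (fun z => (η z.2 * Real.smoothTransition (w z / ε)) • G z) := by
  have trace_comp := h.comp hp hw.1 hG (contDiff_softPos ε)
    (fun s => by rw [deriv_softPos]; exact abs_smoothTransition_le_one (s / ε)) (softPos_zero ε)
  have trace_zero : HasTrace Ω T p (fun z => η z.2 * softPos ε (w z))
      (fun z => (η z.2 * Real.smoothTransition (w z / ε)) • G z) (fun _ => 0) := by
    simp only [deriv_softPos] at trace_comp
    simp only [mul_smul]
    refine (trace_comp.time_mul hη).congr_trace (hg.mono fun z hz => ?_)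
    change η z.2 * softPos ε (g z) = 0
    rw [softPos_of_nonpos hε hz, mul_zero]
  have hgrad : MemLp (fun z => (η z.2 * Real.smoothTransition (w z / ε)) • G z)
      (ENNReal.ofReal p) (cylMeasure Ω T) := by
    simp only [mul_smul]
    refine memLp_time_smul hη.continuous (hG.of_le
      (((continuous_smoothTransition_div ε).comp_aestronglyMeasurable hw.1).smul hG.1)
      (Eventually.of_forall fun z => ?_))
    rw [norm_smul]
    exact mul_le_of_le_one_left (norm_nonneg _) (abs_smoothTransition_le_one _)
  have hvalue := memLp_time_smul hη.continuous (memLp_softPos hw ε)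
  exact ⟨hvalue, hgrad, trace_zero.hasWeakGrad hp hvalue.1 hgrad.1, trace_zero⟩

end Trace

/-! ### Time regularity -/

lemma hasDerivAt_time {φ : SpaceTime N → ℝ} {z : SpaceTime N} (hφ : DifferentiableAt ℝ φ z) :
    HasDerivAt (fun t => φ (z.1, t)) (fderiv ℝ φ z (0, 1)) z.2 :=
  hφ.hasFDerivAt.comp_hasDerivAt z.2 ((hasDerivAt_const z.2 z.1).prodMk (hasDerivAt_id z.2))

instance : IsLocallyFiniteMeasure (cylMeasure Ω T) :=
  inferInstanceAs (IsLocallyFiniteMeasure (volume.restrict _))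

section TimeTail

variable {K : Set (Space N)} {a b : ℝ} {φ : SpaceTime N → ℝ}

/-- The primitive in time of `-φ` that vanishes for large times; a test function with prescribed
time derivative. -/
def timeTail (φ : SpaceTime N → ℝ) (z : SpaceTime N) : ℝ := ∫ s in Ioi z.2, φ (z.1, s)

lemma contDiff_timeTail (hφ : ContDiff ℝ ∞ φ) (hφ₀ : ∀ z ∉ K ×ˢ Icc a b, φ z = 0) :
    ContDiff ℝ ∞ (timeTail φ) := by
  have timeTail_eq_convolution : timeTail φ = fun z => convolution ((Iio (0 : ℝ)).indicator 1)
      (fun s => φ (z.1, s)) (ContinuousLinearMap.lsmul ℝ ℝ) volume z.2 := by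
    ext z
    rw [timeTail, ← integral_indicator measurableSet_Ioi, convolution,
      ← integral_sub_left_eq_self _ volume z.2]
    congr 1 with s
    simp only [indicator, mem_Ioi, mem_Iio, Pi.one_apply, lt_sub_iff_add_lt,
      add_lt_iff_neg_left]
    split_ifs <;> simp
  rw [timeTail_eq_convolution, ← contDiffOn_univ, ← univ_prod_univ]
  refine contDiffOn_convolution_right_with_param (g := fun x s => φ (x, s)) (k := Icc a b)
    _ isOpen_univ isCompact_Icc (fun x s _ hs => hφ₀ _ fun h => hs h.2)
    ((locallyIntegrable_const 1).indicator measurableSet_Iio) hφ.contDiffOn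

lemma integrable_timeSlice (hφ : Continuous φ) (hφ₀ : ∀ z ∉ K ×ˢ Icc a b, φ z = 0)
    (x : Space N) : Integrable fun s => φ (x, s) :=
  (by fun_prop : Continuous fun s => φ (x, s)).integrable_of_hasCompactSupport
    (HasCompactSupport.intro isCompact_Icc fun s hs => hφ₀ _ fun h => hs h.2)

lemma contDiff_timeMean (hφ : ContDiff ℝ ∞ φ) (hφ₀ : ∀ z ∉ K ×ˢ Icc a b, φ z = 0) :
    ContDiff ℝ ∞ fun x => ∫ s, φ (x, s) := by
  have timeTail_eq : (fun x => ∫ s, φ (x, s)) = fun x => timeTail φ (x, a - 1) :=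
    funext fun x => (setIntegral_eq_integral_of_forall_compl_eq_zero fun s hs =>
      hφ₀ _ fun h => hs ((sub_one_lt a).trans_le h.2.1)).symm
  rw [timeTail_eq]
  exact (contDiff_timeTail hφ hφ₀).comp (contDiff_id.prodMk contDiff_const)

lemma fderiv_timeTail (hφ : ContDiff ℝ ∞ φ) (hφ₀ : ∀ z ∉ K ×ˢ Icc a b, φ z = 0)
    (z : SpaceTime N) : fderiv ℝ (timeTail φ) z (0, 1) = -φ z := by
  have hcont : Continuous fun s => φ (z.1, s) := by fun_prop
  have hint := integrable_timeSlice hφ.continuous hφ₀ z.1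
  have timeTail_eq (t : ℝ) : timeTail φ (z.1, t) = timeTail φ z - ∫ s in z.2..t, φ (z.1, s) :=
    eq_sub_of_add_eq' <| intervalIntegral.integral_interval_add_Ioi hint.integrableOn
      hint.integrableOn
  refine (hasDerivAt_time ((contDiff_timeTail hφ hφ₀).differentiable (by simp) z)).unique ?_
  rw [funext timeTail_eq]
  exact (intervalIntegral.integral_hasDerivAt_right (hcont.intervalIntegrable _ _)
    (hcont.stronglyMeasurableAtFilter ..) hcont.continuousAt).const_sub _

lemma timeTail_eq_zero (hφ₀ : ∀ z ∉ K ×ˢ Icc a b, φ z = 0) (hmean : ∀ x, ∫ t, φ (x, t) = 0)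
    {z : SpaceTime N} (hz : z ∉ K ×ˢ Icc a b) : timeTail φ z = 0 := by
  rcases lt_or_ge z.2 a with hza | hza
  · rw [timeTail, ← hmean z.1]
    exact setIntegral_eq_integral_of_forall_compl_eq_zero fun s hs =>
      hφ₀ _ fun h => hs (hza.trans_le h.2.1)
  · refine setIntegral_eq_zero_of_forall_eq_zero fun s hs => hφ₀ _ fun h => hz ⟨h.1, hza, ?_⟩
    exact hs.le.trans h.2.2

lemma HasWeakTimeDeriv.integral_mul_eq_zero {r : SpaceTime N → ℝ} (hr : HasWeakTimeDeriv Ω T r 0)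
    (hK : IsCompact K) (hKΩ : K ⊆ Ω) (ha : 0 < a) (hb : b < T) (hφ : ContDiff ℝ ∞ φ)
    (hφ₀ : ∀ z ∉ K ×ˢ Icc a b, φ z = 0) (hmean : ∀ x, ∫ t, φ (x, t) = 0) :
    ∫ z, r z * φ z ∂cylMeasure Ω T = 0 := by
  have htail (z : SpaceTime N) (hz : z ∉ K ×ˢ Icc a b) : timeTail φ z = 0 :=
    timeTail_eq_zero hφ₀ hmean hz
  have hcompact : IsCompact (K ×ˢ Icc a b) := hK.prod isCompact_Icc
  have hsupport : tsupport (timeTail φ) ⊆ cylinder Ω T :=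
    (closure_minimal (fun z hz => not_imp_comm.1 (htail z) hz) hcompact.isClosed).trans
      (prod_mono hKΩ (Icc_subset_Ioo ha hb))
  simpa [fderiv_timeTail hφ hφ₀, integral_neg] using
    hr (timeTail φ) (contDiff_timeTail hφ hφ₀) (HasCompactSupport.intro hcompact htail) hsupport

end TimeTail

section InitialValue

variable {K : Set (Space N)} {a b : ℝ} {r φ : SpaceTime N → ℝ} {c : Space N → ℝ}

lemma exists_ae_of_eventually_nhdsGT_inf_ae {P : ℝ → Prop}
    (h : ∀ᶠ t in 𝓝[>] 0 ⊓ ae volume, P t) : ∃ b > 0, ∀ᵐ t, t ∈ Ioo 0 b → P t := by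
  obtain ⟨s, hs, s', hs', hP⟩ := eventually_inf.1 h
  obtain ⟨b, hb, hbs⟩ := mem_nhdsGT_iff_exists_Ioo_subset.1 hs
  exact ⟨b, hb, mem_of_superset hs' fun t ht htb => hP t ⟨hbs htb, ht⟩⟩

lemma exists_prod_Icc_of_isCompact_subset_cylinder {S : Set (SpaceTime N)} (hS : IsCompact S)
    (hSQ : S ⊆ cylinder Ω T) :
    ∃ K a b, IsCompact K ∧ K ⊆ Ω ∧ 0 < a ∧ b < T ∧ S ⊆ K ×ˢ Icc a b := by
  rcases S.eq_empty_or_nonempty with rfl | hne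
  · exact ⟨∅, 1, T - 1, isCompact_empty, empty_subset _, one_pos, by linarith, empty_subset _⟩
  obtain ⟨z₁, hz₁, hmin⟩ := hS.exists_isMinOn hne continuous_snd.continuousOn
  obtain ⟨z₂, hz₂, hmax⟩ := hS.exists_isMaxOn hne continuous_snd.continuousOn
  exact ⟨Prod.fst '' S, z₁.2, z₂.2, hS.image continuous_fst, image_subset_iff.2 fun z hz =>
    (hSQ hz).1, (hSQ hz₁).2.1, (hSQ hz₂).2.2, fun z hz => ⟨mem_image_of_mem _ hz, hmin hz, hmax hz⟩⟩

lemma HasWeakTimeDeriv.integral_mul_eq_integral_mul_timeMean (hr : HasWeakTimeDeriv Ω T r 0)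
    (hr_loc : LocallyIntegrable r (cylMeasure Ω T)) (hK : IsCompact K) (hKΩ : K ⊆ Ω) (ha : 0 < a)
    (hb : b < T) (hφ : ContDiff ℝ ∞ φ) (hφ₀ : ∀ z ∉ K ×ˢ Icc a b, φ z = 0) {ρ : ℝ → ℝ}
    (hρ : ContDiff ℝ ∞ ρ) (hρ₀ : ∀ t ∉ Icc a b, ρ t = 0) (hρ₁ : ∫ t, ρ t = 1) :
    ∫ z, r z * φ z ∂cylMeasure Ω T = ∫ z, r z * (ρ z.2 * ∫ s, φ (z.1, s)) ∂cylMeasure Ω T := by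
  have hcompact : IsCompact (K ×ˢ Icc a b) := hK.prod isCompact_Icc
  have hψ : ContDiff ℝ ∞ fun z : SpaceTime N => ρ z.2 * ∫ s, φ (z.1, s) :=
    (hρ.comp contDiff_snd).mul ((contDiff_timeMean hφ hφ₀).comp contDiff_fst)
  have hψ₀ (z : SpaceTime N) (hz : z ∉ K ×ˢ Icc a b) : ρ z.2 * ∫ s, φ (z.1, s) = 0 := by
    rcases not_and_or.1 hz with hx | ht
    · have hzero (s : ℝ) : φ (z.1, s) = 0 := hφ₀ _ fun h => hx h.1
      simp only [hzero, integral_zero, mul_zero]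
    · rw [hρ₀ _ ht, zero_mul]
  have integrable_mul {ψ : SpaceTime N → ℝ} (hψ : ContDiff ℝ ∞ ψ)
      (hψ₀ : ∀ z ∉ K ×ˢ Icc a b, ψ z = 0) : Integrable (fun z => r z * ψ z) (cylMeasure Ω T) :=
    hr_loc.integrable_smul_right_of_hasCompactSupport hψ.continuous
      (HasCompactSupport.intro hcompact hψ₀)
  have hmean (x : Space N) : ∫ t, (φ (x, t) - ρ t * ∫ s, φ (x, s)) = 0 := by
    rw [integral_sub (integrable_timeSlice hφ.continuous hφ₀ x) (Integrable.mul_const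
      (hρ.continuous.integrable_of_hasCompactSupport
        (HasCompactSupport.intro isCompact_Icc hρ₀)) _),
      integral_mul_const, hρ₁, one_mul, sub_self]
  rw [← sub_eq_zero, ← integral_sub (integrable_mul hφ hφ₀) (integrable_mul hψ hψ₀)]
  simp only [← mul_sub]
  exact hr.integral_mul_eq_zero hK hKΩ ha hb (hφ.sub hψ)
    (fun z hz => by rw [hφ₀ z hz, hψ₀ z hz, sub_zero]) hmean

lemma lintegral_enorm_mul_le {α : Type*} {mα : MeasurableSpace α} {μ : Measure α} {f g : α → ℝ}
    (hf : AEStronglyMeasurable f μ) (hg : AEStronglyMeasurable g μ) :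
    ∫⁻ x, ‖f x * g x‖ₑ ∂μ ≤ eLpNorm f 2 μ * eLpNorm g 2 μ := by
  have := eLpNorm_smul_le_mul_eLpNorm (p := 2) (q := 2) (r := 1) hg hf
  simpa only [eLpNorm_one_eq_lintegral_enorm] using! this

lemma ae_aestronglyMeasurable_spaceSlice (hr : AEStronglyMeasurable r (cylMeasure Ω T)) :
    ∀ᵐ t ∂volume.restrict (Ioo 0 T),
      AEStronglyMeasurable (fun x => r (x, t)) (volume.restrict Ω) := by
  rw [cylMeasure_eq_prod] at hr
  exact hr.prod_swap.prodMk_left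

lemma eventually_aestronglyMeasurable_spaceSlice (hT : 0 < T)
    (hr : AEStronglyMeasurable r (cylMeasure Ω T)) :
    ∀ᶠ t in 𝓝[>] 0 ⊓ ae volume,
      AEStronglyMeasurable (fun x => r (x, t)) (volume.restrict Ω) := by
  have hslice := ae_aestronglyMeasurable_spaceSlice hr
  rw [ae_restrict_iff' measurableSet_Ioo] at hslice
  filter_upwards [hslice.filter_mono inf_le_right,
    mem_inf_of_left (Ioo_mem_nhdsGT hT)] with t ht htT using ht htT

lemma enorm_integral_mul_mul_le (hr : AEStronglyMeasurable r (cylMeasure Ω T))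
    {ρ : ℝ → ℝ} (hρ : Continuous ρ) (hc : Continuous c) :
    ‖∫ z, r z * (ρ z.2 * c z.1) ∂cylMeasure Ω T‖ₑ ≤
      ∫⁻ t in Ioo 0 T, ‖ρ t‖ₑ * (eLpNorm c 2 (volume.restrict Ω) *
        eLpNorm (fun x => r (x, t)) 2 (volume.restrict Ω)) := by
  have hmeas : AEStronglyMeasurable (fun z => r z * (ρ z.2 * c z.1)) (cylMeasure Ω T) :=
    hr.mul (by fun_prop : Continuous fun z : SpaceTime N => ρ z.2 * c z.1).aestronglyMeasurable
  calc ‖∫ z, r z * (ρ z.2 * c z.1) ∂cylMeasure Ω T‖ₑ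
      ≤ ∫⁻ z, ‖r z * (ρ z.2 * c z.1)‖ₑ ∂cylMeasure Ω T := enorm_integral_le_lintegral_enorm _
    _ = ∫⁻ t in Ioo 0 T, ∫⁻ x in Ω, ‖ρ t‖ₑ * ‖c x * r (x, t)‖ₑ := by
        rw [cylMeasure_eq_prod] at hmeas ⊢
        rw [lintegral_prod_symm _ hmeas.enorm]
        simp only [enorm_mul, mul_left_comm, mul_comm ‖r _‖ₑ]
    _ ≤ _ := by
        refine lintegral_mono_ae ?_
        filter_upwards [ae_aestronglyMeasurable_spaceSlice hr] with t ht
        rw [lintegral_const_mul' _ _ enorm_ne_top]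
        gcongr
        exact lintegral_enorm_mul_le hc.aestronglyMeasurable ht

lemma exists_contDiff_integral_eq_one {h : ℝ} (hh : 0 < h) : ∃ ρ : ℝ → ℝ, ContDiff ℝ ∞ ρ ∧
    (∀ t ∉ Icc h (3 * h), ρ t = 0) ∧ ∫ t, ρ t = 1 ∧ ∫⁻ t, ‖ρ t‖ₑ = 1 := by
  let bump : ContDiffBump (2 * h) := ⟨h / 2, h, by positivity, by linarith⟩
  have hint : ∫ t, bump.normed volume t = 1 := bump.integral_normed
  refine ⟨bump.normed volume, bump.contDiff_normed, fun t ht => ?_, hint, ?_⟩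
  · refine image_eq_zero_of_notMem_tsupport fun hmem => ht ?_
    rw [bump.tsupport_normed_eq, Real.closedBall_eq_Icc] at hmem
    convert hmem using 2 <;> ring
  · rw [← ofReal_integral_norm_eq_lintegral_enorm bump.integrable_normed]
    simp only [Real.norm_of_nonneg (bump.nonneg_normed _), hint, ENNReal.ofReal_one]

lemma HasWeakTimeDeriv.enorm_integral_mul_le (hr : HasWeakTimeDeriv Ω T r 0) (hT : 0 < T)
    (hr₂ : MemLp r 2 (cylMeasure Ω T)) (hK : IsCompact K) (hKΩ : K ⊆ Ω) (ha : 0 < a) (hb : b < T)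
    (hφ : ContDiff ℝ ∞ φ) (hφ₀ : ∀ z ∉ K ×ˢ Icc a b, φ z = 0) {δ : ℝ≥0∞}
    (hδ : ∀ᶠ t in 𝓝[>] 0 ⊓ ae volume, eLpNorm (fun x => r (x, t)) 2 (volume.restrict Ω) ≤ δ) :
    ‖∫ z, r z * φ z ∂cylMeasure Ω T‖ₑ ≤
      eLpNorm (fun x => ∫ s, φ (x, s)) 2 (volume.restrict Ω) * δ := by
  set c : Space N → ℝ := fun x => ∫ s, φ (x, s)
  obtain ⟨τ, hτ, hτδ⟩ := exists_ae_of_eventually_nhdsGT_inf_ae hδ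
  have hmin : 0 < min τ T := lt_min hτ hT
  obtain ⟨h, hh, hh_lt⟩ : ∃ h > 0, 3 * h < min τ T := ⟨min τ T / 4, by linarith, by linarith⟩
  obtain ⟨ρ, hρ, hρ₀, hρ₁, hρ_enorm⟩ := exists_contDiff_integral_eq_one hh
  have hφ₀' (z : SpaceTime N) (hz : z ∉ K ×ˢ Icc (min a h) (max b (3 * h))) : φ z = 0 :=
    hφ₀ z fun hmem =>
      hz (prod_mono_right (Icc_subset_Icc (min_le_left _ _) (le_max_left _ _)) hmem)
  have hρ₀' (t : ℝ) (ht : t ∉ Icc (min a h) (max b (3 * h))) : ρ t = 0 :=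
    hρ₀ t fun hmem => ht (Icc_subset_Icc (min_le_right _ _) (le_max_right _ _) hmem)
  rw [hr.integral_mul_eq_integral_mul_timeMean (hr₂.locallyIntegrable one_le_two) hK hKΩ
    (lt_min ha hh) (max_lt hb (lt_min_iff.1 hh_lt).2) hφ hφ₀' hρ hρ₀' hρ₁]
  calc ‖∫ z, r z * (ρ z.2 * c z.1) ∂cylMeasure Ω T‖ₑ
      ≤ ∫⁻ t in Ioo 0 T, ‖ρ t‖ₑ * (eLpNorm c 2 (volume.restrict Ω) *
          eLpNorm (fun x => r (x, t)) 2 (volume.restrict Ω)) :=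
        enorm_integral_mul_mul_le hr₂.1 hρ.continuous (contDiff_timeMean hφ hφ₀).continuous
    _ ≤ ∫⁻ t in Ioo 0 T, ‖ρ t‖ₑ * (eLpNorm c 2 (volume.restrict Ω) * δ) := by
        refine lintegral_mono_ae (ae_restrict_of_ae (hτδ.mono fun t ht => ?_))
        by_cases hmem : t ∈ Icc h (3 * h)
        · gcongr
          exact ht ⟨hh.trans_le hmem.1, hmem.2.trans_lt (lt_min_iff.1 hh_lt).1⟩
        · simp only [hρ₀ t hmem, enorm_zero, zero_mul, le_refl]
    _ ≤ ∫⁻ t, ‖ρ t‖ₑ * (eLpNorm c 2 (volume.restrict Ω) * δ) :=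
        lintegral_mono' Measure.restrict_le_self le_rfl
    _ = eLpNorm c 2 (volume.restrict Ω) * δ := by
        rw [lintegral_mul_const _ hρ.continuous.enorm.measurable, hρ_enorm, one_mul]

lemma ae_eq_zero_of_hasWeakTimeDeriv_zero (hΩ : IsOpen Ω) (hT : 0 < T)
    (hr₂ : MemLp r 2 (cylMeasure Ω T)) (hr : HasWeakTimeDeriv Ω T r 0)
    (hlim : Tendsto (fun t => eLpNorm (fun x => r (x, t)) 2 (volume.restrict Ω))
      (𝓝[>] 0 ⊓ ae volume) (𝓝 0)) :
    r =ᵐ[cylMeasure Ω T] 0 := by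
  have hloc : LocallyIntegrable r (cylMeasure Ω T) := hr₂.locallyIntegrable one_le_two
  have hae := (isOpen_cylinder hΩ T).ae_eq_zero_of_integral_contDiff_smul_eq_zero
    (hloc.locallyIntegrableOn _) fun φ hφ hφc hφs => ?_
  · filter_upwards [hae, ae_restrict_mem (isOpen_cylinder hΩ T).measurableSet] with z hz hzQ
    exact hz hzQ
  obtain ⟨K, a, b, hK, hKΩ, ha, hb, hsub⟩ :=
    exists_prod_Icc_of_isCompact_subset_cylinder hφc.isCompact hφs
  have hφ₀ (z : SpaceTime N) (hz : z ∉ K ×ˢ Icc a b) : φ z = 0 :=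
    image_eq_zero_of_notMem_tsupport fun h => hz (hsub h)
  have hmean : MemLp (fun x => ∫ s, φ (x, s)) 2 (volume.restrict Ω) := by
    refine (contDiff_timeMean hφ hφ₀).continuous.memLp_of_hasCompactSupport
      (HasCompactSupport.intro hK fun x hx => ?_)
    have hzero (s : ℝ) : φ (x, s) = 0 := hφ₀ _ fun h => hx h.1
    simp only [hzero, integral_zero]
  have hbound (δ : ℝ≥0∞) (hδ : 0 < δ) := hr.enorm_integral_mul_le hT hr₂ hK hKΩ ha hb hφ hφ₀
    ((hlim.eventually (gt_mem_nhds hδ)).mono fun _ => le_of_lt)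
  have hlim₀ : Tendsto (fun δ => eLpNorm (fun x => ∫ s, φ (x, s)) 2 (volume.restrict Ω) * δ)
      (𝓝[>] 0) (𝓝 0) := by
    simpa using ENNReal.Tendsto.const_mul
      (tendsto_id.mono_left (nhdsWithin_le_nhds (a := 0) (s := Ioi 0)))
      (Or.inr hmean.eLpNorm_ne_top)
  have henorm := ge_of_tendsto hlim₀ (eventually_mem_nhdsWithin.mono hbound)
  simpa only [smul_eq_mul, mul_comm, nonpos_iff_eq_zero, enorm_eq_zero] using henorm

end InitialValue

section Primitive

variable {f : ℝ → ℝ} {a b : ℝ}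

lemma absolutelyContinuousOnInterval_const_add_primitive (hf : IntervalIntegrable f volume a b)
    (c : ℝ) : AbsolutelyContinuousOnInterval (fun t => c + ∫ s in a..t, f s) a b :=
  (contDiff_const (n := 1) (c := c)).contDiffOn.absolutelyContinuousOnInterval.fun_add
    (hf.absolutelyContinuousOnInterval_intervalIntegral left_mem_uIcc)

lemma ae_hasDerivAt_const_add_primitive (hf : IntervalIntegrable f volume a b) (c : ℝ) :
    ∀ᵐ t, t ∈ uIoc a b → HasDerivAt (fun t => c + ∫ s in a..t, f s) (f t) t := by
  filter_upwards [hf.ae_hasDerivAt_integral] with t ht htm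
  exact (ht (uIoc_subset_uIcc htm) a left_mem_uIcc).const_add c

lemma integral_const_add_primitive_mul_deriv (hf : IntervalIntegrable f volume a b) (c : ℝ)
    {φ : ℝ → ℝ} (hφ : ContDiff ℝ 1 φ) (hφa : φ a = 0) (hφb : φ b = 0) :
    ∫ t in a..b, (c + ∫ s in a..t, f s) * deriv φ t = -∫ t in a..b, f t * φ t := by
  rw [(absolutelyContinuousOnInterval_const_add_primitive hf c).integral_mul_deriv_eq_deriv_mul
    hφ.contDiffOn.absolutelyContinuousOnInterval, hφa, hφb, mul_zero, mul_zero, sub_zero, zero_sub]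
  congr 1
  refine intervalIntegral.integral_congr_ae ?_
  filter_upwards [ae_hasDerivAt_const_add_primitive hf c] with t ht htm
  rw [(ht htm).deriv]

end Primitive

section TimePrim

variable {g : SpaceTime N → ℝ}

/-- The primitive in time of `g` that vanishes at time zero. -/
def timePrim (g : SpaceTime N → ℝ) (z : SpaceTime N) : ℝ := ∫ s in (0 : ℝ)..z.2, g (z.1, s)

lemma stronglyMeasurable_timePrim (hg : StronglyMeasurable g) :
    StronglyMeasurable (timePrim g) := by
  have setIntegral_Ioc {l u : SpaceTime N → ℝ} (hl : Measurable l) (hu : Measurable u) :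
      StronglyMeasurable fun z => ∫ s in Ioc (l z) (u z), g (z.1, s) := by
    have hS : MeasurableSet {y : SpaceTime N × ℝ | y.2 ∈ Ioc (l y.1) (u y.1)} :=
      (measurableSet_lt (hl.comp measurable_fst) measurable_snd).inter
        (measurableSet_le measurable_snd (hu.comp measurable_fst))
    have hind := ((hg.comp_measurable (by fun_prop : Measurable fun y : SpaceTime N × ℝ =>
      (y.1.1, y.2))).indicator hS).integral_prod_right' (ν := volume)
    simpa only [← integral_indicator measurableSet_Ioc] using! hind
  exact (setIntegral_Ioc measurable_const measurable_snd).sub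
    (setIntegral_Ioc measurable_snd measurable_const)

lemma sq_eLpNorm_two {α E : Type*} [NormedAddCommGroup E] {mα : MeasurableSpace α}
    (μ : Measure α) (f : α → E) : eLpNorm f 2 μ ^ 2 = ∫⁻ x, ‖f x‖ₑ ^ 2 ∂μ := by
  rw [eLpNorm_eq_lintegral_rpow_enorm_toReal two_ne_zero ENNReal.ofNat_ne_top,
    ← ENNReal.rpow_natCast, ← ENNReal.rpow_mul]
  simp

lemma sq_enorm_timePrim_le (hg : StronglyMeasurable g) (x : Space N) {t : ℝ} (ht : t ∈ Ioo 0 T) :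
    ‖timePrim g (x, t)‖ₑ ^ 2 ≤ ENNReal.ofReal t * ∫⁻ s in Ioo 0 T, ‖g (x, s)‖ₑ ^ 2 := by
  have hslice : StronglyMeasurable fun s => g (x, s) := hg.comp_measurable measurable_prodMk_left
  have hcauchy : ‖timePrim g (x, t)‖ₑ ≤
      eLpNorm (fun _ : ℝ => (1 : ℝ)) 2 (volume.restrict (Ioc 0 t)) *
        eLpNorm (fun s => g (x, s)) 2 (volume.restrict (Ioc 0 t)) := by
    rw [timePrim, intervalIntegral.integral_of_le ht.1.le]
    refine (enorm_integral_le_lintegral_enorm _).trans ?_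
    simpa only [one_mul] using lintegral_enorm_mul_le
      (aestronglyMeasurable_const (b := (1 : ℝ))) hslice.aestronglyMeasurable
  refine (pow_le_pow_left' hcauchy 2).trans ?_
  rw [mul_pow, sq_eLpNorm_two, sq_eLpNorm_two]
  simp only [enorm_one, one_pow, lintegral_const, one_mul, Measure.restrict_apply_univ,
    Real.volume_Ioc, sub_zero]
  gcongr
  exact ht.2

lemma sq_eLpNorm_timePrim_slice_le (hg : StronglyMeasurable g) {t : ℝ} (ht : t ∈ Ioo 0 T) :
    eLpNorm (fun x => timePrim g (x, t)) 2 (volume.restrict Ω) ^ 2 ≤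
      ENNReal.ofReal t * eLpNorm g 2 (cylMeasure Ω T) ^ 2 := by
  rw [sq_eLpNorm_two, sq_eLpNorm_two, cylMeasure_eq_prod,
    lintegral_prod _ (hg.enorm.pow_const 2).aemeasurable,
    ← lintegral_const_mul' _ _ ENNReal.ofReal_ne_top]
  exact lintegral_mono fun x => sq_enorm_timePrim_le hg x ht

lemma memLp_two_timePrim (hg : StronglyMeasurable g) (hg₂ : MemLp g 2 (cylMeasure Ω T)) :
    MemLp (timePrim g) 2 (cylMeasure Ω T) := by
  have hmeas := stronglyMeasurable_timePrim hg
  refine ⟨hmeas.aestronglyMeasurable, ?_⟩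
  suffices h : eLpNorm (timePrim g) 2 (cylMeasure Ω T) ^ 2 < ⊤ from
    (ENNReal.pow_lt_top_iff.1 h).resolve_right two_ne_zero
  calc eLpNorm (timePrim g) 2 (cylMeasure Ω T) ^ 2
      = ∫⁻ t in Ioo 0 T, eLpNorm (fun x => timePrim g (x, t)) 2 (volume.restrict Ω) ^ 2 := by
        simp only [sq_eLpNorm_two]
        rw [cylMeasure_eq_prod, lintegral_prod_symm _ (hmeas.enorm.pow_const 2).aemeasurable]
    _ ≤ ∫⁻ _ in Ioo 0 T, ENNReal.ofReal T * eLpNorm g 2 (cylMeasure Ω T) ^ 2 := by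
        refine setLIntegral_mono measurable_const fun t ht => ?_
        refine (sq_eLpNorm_timePrim_slice_le hg ht).trans ?_
        gcongr
        exact ht.2.le
    _ < ⊤ := by
        rw [setLIntegral_const]
        exact ENNReal.mul_lt_top (ENNReal.mul_lt_top ENNReal.ofReal_lt_top
          (ENNReal.pow_lt_top hg₂.eLpNorm_lt_top)) measure_Ioo_lt_top

lemma tendsto_eLpNorm_timePrim_slice (hT : 0 < T) (hg : StronglyMeasurable g)
    (hg₂ : MemLp g 2 (cylMeasure Ω T)) :
    Tendsto (fun t => eLpNorm (fun x => timePrim g (x, t)) 2 (volume.restrict Ω))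
      (𝓝[>] 0) (𝓝 0) := by
  have hlim : Tendsto (fun t => ENNReal.ofReal t * eLpNorm g 2 (cylMeasure Ω T) ^ 2)
      (𝓝[>] 0) (𝓝 0) := by
    simpa using ENNReal.Tendsto.mul_const ((ENNReal.tendsto_ofReal tendsto_id).mono_left
      (nhdsWithin_le_nhds (a := 0) (s := Ioi 0))) (Or.inr (ENNReal.pow_ne_top hg₂.eLpNorm_ne_top))
  have hsq : Tendsto (fun t => eLpNorm (fun x => timePrim g (x, t)) 2 (volume.restrict Ω) ^ 2)
      (𝓝[>] 0) (𝓝 0) :=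
    tendsto_of_tendsto_of_tendsto_of_le_of_le' tendsto_const_nhds hlim
      (Eventually.of_forall fun _ => zero_le)
      (mem_of_superset (Ioo_mem_nhdsGT hT) fun t ht => sq_eLpNorm_timePrim_slice_le hg ht)
  have hsqrt (c : ℝ≥0∞) : (c ^ 2) ^ (1 / 2 : ℝ) = c := by
    rw [← ENNReal.rpow_natCast, ← ENNReal.rpow_mul]
    simp
  simpa only [hsqrt, ENNReal.zero_rpow_of_pos one_half_pos] using hsq.ennrpow_const (1 / 2)

lemma ae_intervalIntegrable_timeSlice (hT : 0 ≤ T) (hg₂ : MemLp g 2 (cylMeasure Ω T)) :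
    ∀ᵐ x ∂volume.restrict Ω, IntervalIntegrable (fun s => g (x, s)) volume 0 T := by
  rw [cylMeasure_eq_prod] at hg₂
  filter_upwards [hg₂.1.prodMk_left, hg₂.integrable_sq.prod_right_ae] with x hmeas hsq
  exact (intervalIntegrable_iff_integrableOn_Ioo_of_le hT).2
    (((memLp_two_iff_integrable_sq hmeas).2 hsq).integrable one_le_two)

variable {w : SpaceTime N → ℝ} {a : Space N → ℝ}

lemma memLp_two_add_timePrim (ha : MemLp a 2 (volume.restrict Ω)) (hg : StronglyMeasurable g)
    (hg₂ : MemLp g 2 (cylMeasure Ω T)) :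
    MemLp (fun z => a z.1 + timePrim g z) 2 (cylMeasure Ω T) := by
  have ha_fst := ha.comp_fst (volume.restrict (Ioo 0 T))
  rw [← cylMeasure_eq_prod] at ha_fst
  exact ha_fst.add (memLp_two_timePrim hg hg₂)

lemma hasWeakTimeDeriv_add_timePrim (hT : 0 ≤ T) (ha : MemLp a 2 (volume.restrict Ω))
    (hg : StronglyMeasurable g) (hg₂ : MemLp g 2 (cylMeasure Ω T)) :
    HasWeakTimeDeriv Ω T (fun z => a z.1 + timePrim g z) g := by
  intro φ hφ hφc hφs
  have hint : Integrable (fun z => (a z.1 + timePrim g z) * fderiv ℝ φ z (0, 1))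
      (cylMeasure Ω T) :=
    ((memLp_two_add_timePrim ha hg hg₂).locallyIntegrable
      one_le_two).integrable_smul_right_of_hasCompactSupport
      ((hφ.continuous_fderiv (by simp)).clm_apply continuous_const) (hφc.fderiv_apply ℝ _)
  have hint' : Integrable (fun z => g z * φ z) (cylMeasure Ω T) :=
    (hg₂.locallyIntegrable one_le_two).integrable_smul_right_of_hasCompactSupport hφ.continuous hφc
  rw [cylMeasure_eq_prod] at hint hint' ⊢
  rw [integral_prod _ hint, integral_prod _ hint', ← integral_neg]
  refine integral_congr_ae ?_
  filter_upwards [ae_intervalIntegrable_timeSlice hT hg₂] with x hx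
  have hφ_zero (t : ℝ) (ht : t ∉ Ioo 0 T) : φ (x, t) = 0 :=
    image_eq_zero_of_notMem_tsupport fun h => ht (hφs h).2
  have hφ_deriv (t : ℝ) : deriv (fun t => φ (x, t)) t = fderiv ℝ φ (x, t) (0, 1) :=
    (hasDerivAt_time (hφ.differentiable (by simp) (x, t))).deriv
  simp only [← integral_Ioc_eq_integral_Ioo, ← intervalIntegral.integral_of_le hT, ← hφ_deriv]
  exact integral_const_add_primitive_mul_deriv hx (a x)
    ((hφ.of_le (by simp)).comp (contDiff_const.prodMk contDiff_id))
    (hφ_zero 0 (by simp)) (hφ_zero T (by simp))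

lemma tendsto_eLpNorm_sub_add_timePrim (hT : 0 < T) (hw : AEStronglyMeasurable w (cylMeasure Ω T))
    (ha : HasInitialValue Ω w a) (hg : StronglyMeasurable g) (hg₂ : MemLp g 2 (cylMeasure Ω T)) :
    Tendsto (fun t => eLpNorm (fun x => w (x, t) - (a x + timePrim g (x, t))) 2
      (volume.restrict Ω)) (𝓝[>] 0 ⊓ ae volume) (𝓝 0) := by
  have hsum := ha.2.add ((tendsto_eLpNorm_timePrim_slice hT hg hg₂).mono_left inf_le_left)
  rw [add_zero] at hsum
  refine tendsto_of_tendsto_of_tendsto_of_le_of_le' tendsto_const_nhds hsum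
    (Eventually.of_forall fun _ => zero_le) ?_
  filter_upwards [eventually_aestronglyMeasurable_spaceSlice hT hw] with t ht
  simp only [← sub_sub]
  exact eLpNorm_sub_le (ht.sub ha.1.1) ((stronglyMeasurable_timePrim hg).comp_measurable
    measurable_prodMk_right).aestronglyMeasurable one_le_two

lemma HasWeakTimeDeriv.ae_eq_add_timePrim (hwt : HasWeakTimeDeriv Ω T w g) (hΩ : IsOpen Ω)
    (hT : 0 < T) (hw : MemLp w 2 (cylMeasure Ω T)) (hg : StronglyMeasurable g)
    (hg₂ : MemLp g 2 (cylMeasure Ω T)) (ha : HasInitialValue Ω w a) :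
    w =ᵐ[cylMeasure Ω T] fun z => a z.1 + timePrim g z := by
  have hrep := memLp_two_add_timePrim ha.1 hg hg₂
  have hzero : HasWeakTimeDeriv Ω T (w - fun z => a z.1 + timePrim g z) 0 := by
    rw [← sub_self g]
    exact hwt.sub (hasWeakTimeDeriv_add_timePrim hT.le ha.1 hg hg₂)
      (hw.locallyIntegrable one_le_two) (hrep.locallyIntegrable one_le_two)
      (hg₂.locallyIntegrable one_le_two) (hg₂.locallyIntegrable one_le_two)
  exact (sub_ae_eq_zero _ _).1 <| ae_eq_zero_of_hasWeakTimeDeriv_zero hΩ hT (hw.sub hrep) hzero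
    (tendsto_eLpNorm_sub_add_timePrim hT hw.1 ha hg hg₂)

end TimePrim

/-! ### The energy inequality -/

section Energy

variable {K ε : ℝ}

lemma absolutelyContinuousOnInterval_comp_contDiff {f Φ : ℝ → ℝ} {a b : ℝ}
    (hf : AbsolutelyContinuousOnInterval f a b) (hΦ : ContDiff ℝ 1 Φ) :
    AbsolutelyContinuousOnInterval (fun t => Φ (f t)) a b := by
  obtain ⟨C, hC⟩ := hf.exists_bound
  obtain ⟨L, hL⟩ := hΦ.contDiffOn.exists_lipschitzOnWith (s := Icc (-C) C) (n := 1) (by simp)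
    (convex_Icc _ _) isCompact_Icc
  have hmem (t : ℝ) (ht : t ∈ uIcc a b) : f t ∈ Icc (-C) C := abs_le.1 (hC t ht)
  unfold AbsolutelyContinuousOnInterval at hf ⊢
  refine squeeze_zero' (Eventually.of_forall fun _ => Finset.sum_nonneg fun _ _ => dist_nonneg) ?_
    (by simpa only [mul_zero] using hf.const_mul (L : ℝ))
  rw [eventually_inf_principal]
  refine Eventually.of_forall fun E hE => ?_
  rw [Finset.mul_sum]
  exact Finset.sum_le_sum fun i hi =>
    hL.dist_le_mul _ (hmem _ (hE.1 i hi).1) _ (hmem _ (hE.1 i hi).2)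

section Slice

variable {f : ℝ → ℝ} {c : ℝ}

lemma continuousOn_const_add_primitive (hf : IntervalIntegrable f volume 0 T) :
    ContinuousOn (fun t => c + ∫ s in (0 : ℝ)..t, f s) (uIcc 0 T) :=
  (absolutelyContinuousOnInterval_const_add_primitive hf c).continuousOn

lemma integral_exp_mul_softPosPrim_le (hε : 0 < ε) (hc : c ≤ 0)
    (hf : IntervalIntegrable f volume 0 T) :
    ∫ t in (0 : ℝ)..T, Real.exp (-K * t) * (K * softPosPrim ε (c + ∫ s in (0 : ℝ)..t, f s)) ≤
      ∫ t in (0 : ℝ)..T, Real.exp (-K * t) * (f t * softPos ε (c + ∫ s in (0 : ℝ)..t, f s)) := by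
  set W : ℝ → ℝ := fun t => c + ∫ s in (0 : ℝ)..t, f s
  have hW : ContinuousOn W (uIcc 0 T) := continuousOn_const_add_primitive hf
  have hE : ContDiff ℝ 1 fun t : ℝ => Real.exp (-K * t) := by fun_prop
  have hftc := (hE.contDiffOn.absolutelyContinuousOnInterval
    (a := 0) (b := T)).integral_deriv_mul_eq_sub (absolutelyContinuousOnInterval_comp_contDiff
      (absolutelyContinuousOnInterval_const_add_primitive hf c) (contDiff_softPosPrim ε))
  rw [intervalIntegral.integral_same, add_zero, softPosPrim_of_nonpos hε hc, mul_zero,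
    sub_zero] at hftc
  have hsoft : ContinuousOn (fun t => softPos ε (W t)) (uIcc 0 T) :=
    (continuous_softPos ε).comp_continuousOn hW
  have hprim : ContinuousOn (fun t => Real.exp (-K * t) * (K * softPosPrim ε (W t))) (uIcc 0 T) :=
    hE.continuous.continuousOn.mul
      (continuousOn_const.mul ((contDiff_softPosPrim ε).continuous.comp_continuousOn hW))
  rw [← sub_nonneg, ← intervalIntegral.integral_sub
    ((hf.mul_continuousOn hsoft).continuousOn_mul hE.continuous.continuousOn)
    hprim.intervalIntegrable]
  calc 0 ≤ Real.exp (-K * T) * softPosPrim ε (W T) :=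
        mul_nonneg (Real.exp_pos _).le (softPosPrim_nonneg hε _)
    _ = _ := hftc.symm
    _ = _ := intervalIntegral.integral_congr_ae ?_
  filter_upwards [ae_hasDerivAt_const_add_primitive hf c] with t ht htm
  have hE_deriv : HasDerivAt (fun t : ℝ => Real.exp (-K * t)) (Real.exp (-K * t) * (-K * 1)) t :=
    ((hasDerivAt_id t).const_mul (-K)).exp
  have hprim_deriv : HasDerivAt (fun t => softPosPrim ε (W t)) (softPos ε (W t) * f t) t :=
    (hasDerivAt_softPosPrim ε (W t)).comp t (ht htm)
  rw [hprim_deriv.deriv, hE_deriv.deriv]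
  ring

lemma integral_exp_mul_sq_softPos_le (hT : 0 ≤ T) (hK : 0 ≤ K) (hε : 0 < ε) (hc : c ≤ 0)
    (hf : IntervalIntegrable f volume 0 T) :
    ∫ t in (0 : ℝ)..T, Real.exp (-K * t) * (K / 2 * softPos ε (c + ∫ s in (0 : ℝ)..t, f s) ^ 2) ≤
      ∫ t in (0 : ℝ)..T, Real.exp (-K * t) * (f t * softPos ε (c + ∫ s in (0 : ℝ)..t, f s)) := by
  refine le_trans ?_ (integral_exp_mul_softPosPrim_le hε hc hf)
  have hW := continuousOn_const_add_primitive (c := c) hf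
  have hE : ContinuousOn (fun t : ℝ => Real.exp (-K * t)) (uIcc 0 T) := by fun_prop
  refine intervalIntegral.integral_mono hT
    (hE.fun_mul (continuousOn_const.fun_mul
      (((continuous_softPos ε).comp_continuousOn hW).fun_pow 2))).intervalIntegrable
    (hE.fun_mul (continuousOn_const.fun_mul
      ((contDiff_softPosPrim ε).continuous.comp_continuousOn hW))).intervalIntegrable
    fun t => ?_
  simp only
  rw [div_mul_eq_mul_div, mul_div_assoc]
  gcongr
  exact sq_softPos_div_two_le_softPosPrim hε _

end Slice

variable {w g : SpaceTime N → ℝ} {a : Space N → ℝ}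

lemma integral_exp_mul_sq_softPos_le_of_ae_eq (hT : 0 ≤ T) (hK : 0 ≤ K) (hε : 0 < ε)
    (hw : MemLp w 2 (cylMeasure Ω T)) (hg : MemLp g 2 (cylMeasure Ω T))
    (hrep : w =ᵐ[cylMeasure Ω T] fun z => a z.1 + timePrim g z)
    (ha : ∀ᵐ x ∂volume.restrict Ω, a x ≤ 0) :
    ∫ z, Real.exp (-K * z.2) * (K / 2 * softPos ε (w z) ^ 2) ∂cylMeasure Ω T ≤
      ∫ z, Real.exp (-K * z.2) * (g z * softPos ε (w z)) ∂cylMeasure Ω T := by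
  have hη : Continuous fun t : ℝ => Real.exp (-K * t) := by fun_prop
  have hsoft : MemLp (fun z => softPos ε (w z)) 2 (cylMeasure Ω T) := memLp_softPos hw ε
  have hsq := integrable_time_mul hη (hsoft.integrable_sq.const_mul (K / 2))
  have hmul := integrable_time_mul hη (hg.integrable_mul hsoft)
  have hslice := ae_intervalIntegrable_timeSlice hT hg
  simp only [Pi.mul_apply] at hmul
  rw [cylMeasure_eq_prod] at hrep hsq hmul ⊢
  rw [integral_prod _ hsq, integral_prod _ hmul]
  refine integral_mono_ae hsq.integral_prod_left hmul.integral_prod_left ?_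
  filter_upwards [ha, Measure.ae_ae_of_ae_prod hrep, hslice] with x hax hwx hgx
  have hle := integral_exp_mul_sq_softPos_le hT hK hε hax hgx
  simp only [intervalIntegral.integral_of_le hT, integral_Ioc_eq_integral_Ioo] at hle
  calc _ = _ := integral_congr_ae (hwx.mono fun t ht => by simp only [ht, timePrim])
    _ ≤ _ := hle
    _ = _ := integral_congr_ae (hwx.mono fun t ht => by simp only [ht, timePrim])

lemma HasWeakTimeDeriv.congr_ae {g' : SpaceTime N → ℝ} (h : HasWeakTimeDeriv Ω T w g)
    (hg : g =ᵐ[cylMeasure Ω T] g') : HasWeakTimeDeriv Ω T w g' := by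
  intro φ hφ hφc hφs
  rw [h φ hφ hφc hφs]
  exact congrArg _ (integral_congr_ae (hg.mul (ae_eq_refl φ)))

lemma HasWeakTimeDeriv.integral_exp_mul_sq_softPos_le (hwt : HasWeakTimeDeriv Ω T w g)
    (hΩ : IsOpen Ω) (hT : 0 < T) (hK : 0 ≤ K) (hε : 0 < ε) (hw : MemLp w 2 (cylMeasure Ω T))
    (hg : MemLp g 2 (cylMeasure Ω T)) (ha : HasInitialValue Ω w a)
    (ha₀ : ∀ᵐ x ∂volume.restrict Ω, a x ≤ 0) :
    ∫ z, Real.exp (-K * z.2) * (K / 2 * softPos ε (w z) ^ 2) ∂cylMeasure Ω T ≤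
      ∫ z, Real.exp (-K * z.2) * (g z * softPos ε (w z)) ∂cylMeasure Ω T := by
  have hg' : MemLp (hg.1.mk g) 2 (cylMeasure Ω T) := hg.ae_eq hg.1.ae_eq_mk
  refine (integral_exp_mul_sq_softPos_le_of_ae_eq hT.le hK hε hw hg'
    ((hwt.congr_ae hg.1.ae_eq_mk).ae_eq_add_timePrim hΩ hT hw hg.1.stronglyMeasurable_mk hg' ha)
    ha₀).trans_eq (integral_congr_ae ?_)
  filter_upwards [hg.1.ae_eq_mk] with z hz
  rw [hz]

end Energy

/-! ### Sub- and supersolutions of a scalar equation -/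

section ScalarComparison

/-- `u`, with `∂u/∂t = ut` and `∇u = Du`, is a weak subsolution of the scalar problem
`u_t = div(|∇u|^{p-2}∇u) + f` with zero lateral data and initial data `u₀`.  Freezing the source
term splits the system into two such problems. -/
structure IsScalarSubsolution (Ω : Set (Space N)) (T p : ℝ) (f : SpaceTime N → ℝ)
    (u₀ : Space N → ℝ) (u ut : SpaceTime N → ℝ) (Du : SpaceTime N → Space N) : Prop where
  memLp_source : MemLp f 2 (cylMeasure Ω T)
  memLp_two : MemLp u 2 (cylMeasure Ω T)
  memLp_timeDeriv : MemLp ut 2 (cylMeasure Ω T)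
  memLp_grad : MemLp Du (ENNReal.ofReal p) (cylMeasure Ω T)
  timeDeriv : HasWeakTimeDeriv Ω T u ut
  weakForm_le : ∀ φ Dφ, MemEZero Ω T p φ Dφ → (∀ᵐ z ∂cylMeasure Ω T, 0 ≤ φ z) →
    weakForm Ω T p ut Du φ Dφ ≤ ∫ z, f z * φ z ∂cylMeasure Ω T
  exists_trace_nonpos : ∃ g, HasTrace Ω T p u Du g ∧ ∀ᵐ z ∂lateralMeasure Ω T, g z ≤ 0
  exists_initial_le : ∃ a, HasInitialValue Ω u a ∧ ∀ᵐ x ∂volume.restrict Ω, a x ≤ u₀ x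

/-- The supersolution counterpart of `IsScalarSubsolution`. -/
structure IsScalarSupersolution (Ω : Set (Space N)) (T p : ℝ) (f : SpaceTime N → ℝ)
    (u₀ : Space N → ℝ) (u ut : SpaceTime N → ℝ) (Du : SpaceTime N → Space N) : Prop where
  memLp_source : MemLp f 2 (cylMeasure Ω T)
  memLp_two : MemLp u 2 (cylMeasure Ω T)
  memLp_timeDeriv : MemLp ut 2 (cylMeasure Ω T)
  memLp_grad : MemLp Du (ENNReal.ofReal p) (cylMeasure Ω T)
  timeDeriv : HasWeakTimeDeriv Ω T u ut
  le_weakForm : ∀ φ Dφ, MemEZero Ω T p φ Dφ → (∀ᵐ z ∂cylMeasure Ω T, 0 ≤ φ z) →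
    ∫ z, f z * φ z ∂cylMeasure Ω T ≤ weakForm Ω T p ut Du φ Dφ
  exists_trace_nonneg : ∃ g, HasTrace Ω T p u Du g ∧ ∀ᵐ z ∂lateralMeasure Ω T, 0 ≤ g z
  exists_le_initial : ∃ a, HasInitialValue Ω u a ∧ ∀ᵐ x ∂volume.restrict Ω, u₀ x ≤ a x

lemma IsWeakSubsolution.exists_isScalarSubsolution {q m n : ℝ} {u₀ v₀ : Space N → ℝ}
    {u v : SpaceTime N → ℝ} (h : IsWeakSubsolution Ω T p q m n u₀ v₀ u v) (hm : 0 < m)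
    (hn : 0 < n) :
    (∃ ut Du, IsScalarSubsolution Ω T p (fun z => v z ^ m) u₀ u ut Du) ∧
      ∃ vt Dv, IsScalarSubsolution Ω T q (fun z => u z ^ n) v₀ v vt Dv := by
  obtain ⟨hnonneg, ut, vt, Du, Dv, hu, hv, hu_le, hv_le, hu_trace, hv_trace, hu_init, hv_init⟩ := h
  exact ⟨⟨ut, Du, memLp_two_rpow hm hv.memLp_two_mul (hnonneg.mono fun _ => And.right),
      hu.memLp_two, hu.memLp_timeDeriv, hu.memLp_grad, hu.timeDeriv, hu_le, hu_trace, hu_init⟩,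
    vt, Dv, memLp_two_rpow hn hu.memLp_two_mul (hnonneg.mono fun _ => And.left),
      hv.memLp_two, hv.memLp_timeDeriv, hv.memLp_grad, hv.timeDeriv, hv_le, hv_trace, hv_init⟩

lemma IsWeakSupersolution.exists_isScalarSupersolution {q m n : ℝ} {u₀ v₀ : Space N → ℝ}
    {u v : SpaceTime N → ℝ} (h : IsWeakSupersolution Ω T p q m n u₀ v₀ u v) (hm : 0 < m)
    (hn : 0 < n) :
    (∃ ut Du, IsScalarSupersolution Ω T p (fun z => v z ^ m) u₀ u ut Du) ∧
      ∃ vt Dv, IsScalarSupersolution Ω T q (fun z => u z ^ n) v₀ v vt Dv := by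
  obtain ⟨hnonneg, ut, vt, Du, Dv, hu, hv, hu_le, hv_le, hu_trace, hv_trace, hu_init, hv_init⟩ := h
  exact ⟨⟨ut, Du, memLp_two_rpow hm hv.memLp_two_mul (hnonneg.mono fun _ => And.right),
      hu.memLp_two, hu.memLp_timeDeriv, hu.memLp_grad, hu.timeDeriv, hu_le, hu_trace, hu_init⟩,
    vt, Dv, memLp_two_rpow hn hu.memLp_two_mul (hnonneg.mono fun _ => And.left),
      hv.memLp_two, hv.memLp_timeDeriv, hv.memLp_grad, hv.timeDeriv, hv_le, hv_trace, hv_init⟩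

lemma HasInitialValue.sub {w₁ w₂ : SpaceTime N → ℝ} {a₁ a₂ : Space N → ℝ}
    (h₁ : HasInitialValue Ω w₁ a₁) (h₂ : HasInitialValue Ω w₂ a₂) (hT : 0 < T)
    (hw₁ : AEStronglyMeasurable w₁ (cylMeasure Ω T))
    (hw₂ : AEStronglyMeasurable w₂ (cylMeasure Ω T)) :
    HasInitialValue Ω (w₁ - w₂) (a₁ - a₂) := by
  refine ⟨h₁.1.sub h₂.1, ?_⟩
  have hsum := h₁.2.add h₂.2
  rw [add_zero] at hsum
  refine tendsto_of_tendsto_of_tendsto_of_le_of_le' tendsto_const_nhds hsum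
    (Eventually.of_forall fun _ => zero_le) ?_
  filter_upwards [eventually_aestronglyMeasurable_spaceSlice hT hw₁,
    eventually_aestronglyMeasurable_spaceSlice hT hw₂] with t ht₁ ht₂
  refine (eLpNorm_congr_ae (Eventually.of_forall fun x => ?_)).trans_le
    (eLpNorm_sub_le (ht₁.sub h₁.1.1) (ht₂.sub h₂.1.1) one_le_two)
  simp only [Pi.sub_apply]
  ring

section Pair

variable {f₁ f₂ u₁ u₂ ut₁ ut₂ : SpaceTime N → ℝ} {u₀ : Space N → ℝ}
  {D₁ D₂ : SpaceTime N → Space N} {K ε : ℝ}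

lemma MemEZero.integrable_weakForm {φ : SpaceTime N → ℝ} {Dφ : SpaceTime N → Space N}
    (hφ : MemEZero Ω T p φ Dφ) (hp : 1 < p) (hut : MemLp ut₁ 2 (cylMeasure Ω T))
    (hD : MemLp D₁ (ENNReal.ofReal p) (cylMeasure Ω T)) :
    Integrable (fun z => ut₁ z * φ z + ‖D₁ z‖ ^ (p - 2) * inner ℝ (D₁ z) (Dφ z))
      (cylMeasure Ω T) :=
  (hut.integrable_mul hφ.memLp_two).add (integrable_pLaplace_inner hp hD hφ.memLp_grad)

-- Monotonicity of the `p`-Laplacian lets the diffusion terms drop out with a favourable sign.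
lemma integral_timeDeriv_sub_mul_le_weakForm_sub (hp : 1 < p)
    (hut₁ : MemLp ut₁ 2 (cylMeasure Ω T)) (hut₂ : MemLp ut₂ 2 (cylMeasure Ω T))
    (hD₁ : MemLp D₁ (ENNReal.ofReal p) (cylMeasure Ω T))
    (hD₂ : MemLp D₂ (ENNReal.ofReal p) (cylMeasure Ω T)) {φ ρ : SpaceTime N → ℝ}
    (hφ : MemEZero Ω T p φ fun z => ρ z • (D₁ - D₂) z) (hρ₀ : ∀ z, 0 ≤ ρ z) :
    ∫ z, (ut₁ - ut₂) z * φ z ∂cylMeasure Ω T ≤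
      weakForm Ω T p ut₁ D₁ φ (fun z => ρ z • (D₁ - D₂) z) -
        weakForm Ω T p ut₂ D₂ φ (fun z => ρ z • (D₁ - D₂) z) := by
  have hform₁ := hφ.integrable_weakForm hp hut₁ hD₁
  have hform₂ := hφ.integrable_weakForm hp hut₂ hD₂
  rw [weakForm, weakForm, ← integral_sub hform₁ hform₂]
  refine integral_mono ((hut₁.sub hut₂).integrable_mul hφ.memLp_two) (hform₁.sub hform₂) fun z => ?_
  have hmono := mul_nonneg (hρ₀ z) (inner_pLaplace_sub_nonneg hp (D₁ z) (D₂ z))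
  simp only [Pi.sub_apply, inner_smul_right]
  linarith

lemma IsScalarSubsolution.integral_timeDeriv_sub_mul_le
    (h₁ : IsScalarSubsolution Ω T p f₁ u₀ u₁ ut₁ D₁)
    (h₂ : IsScalarSupersolution Ω T p f₂ u₀ u₂ ut₂ D₂) (hp : 1 < p) {φ ρ : SpaceTime N → ℝ}
    (hφ : MemEZero Ω T p φ fun z => ρ z • (D₁ - D₂) z) (hφ₀ : ∀ z, 0 ≤ φ z)
    (hρ₀ : ∀ z, 0 ≤ ρ z) :
    ∫ z, (ut₁ - ut₂) z * φ z ∂cylMeasure Ω T ≤ ∫ z, (f₁ - f₂) z * φ z ∂cylMeasure Ω T := by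
  have hφ_ae : ∀ᵐ z ∂cylMeasure Ω T, 0 ≤ φ z := Eventually.of_forall hφ₀
  calc ∫ z, (ut₁ - ut₂) z * φ z ∂cylMeasure Ω T
      ≤ weakForm Ω T p ut₁ D₁ φ (fun z => ρ z • (D₁ - D₂) z) -
          weakForm Ω T p ut₂ D₂ φ (fun z => ρ z • (D₁ - D₂) z) :=
        integral_timeDeriv_sub_mul_le_weakForm_sub hp h₁.memLp_timeDeriv h₂.memLp_timeDeriv
          h₁.memLp_grad h₂.memLp_grad hφ hρ₀
    _ ≤ ∫ z, f₁ z * φ z ∂cylMeasure Ω T - ∫ z, f₂ z * φ z ∂cylMeasure Ω T :=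
        sub_le_sub (h₁.weakForm_le _ _ hφ hφ_ae) (h₂.le_weakForm _ _ hφ hφ_ae)
    _ = ∫ z, (f₁ - f₂) z * φ z ∂cylMeasure Ω T := by
        simp only [Pi.sub_apply, sub_mul]
        exact (integral_sub (h₁.memLp_source.integrable_mul hφ.memLp_two)
          (h₂.memLp_source.integrable_mul hφ.memLp_two)).symm

lemma IsScalarSubsolution.integral_exp_mul_sq_softPos_le
    (h₁ : IsScalarSubsolution Ω T p f₁ u₀ u₁ ut₁ D₁)
    (h₂ : IsScalarSupersolution Ω T p f₂ u₀ u₂ ut₂ D₂) (hΩ : IsOpen Ω) (hT : 0 < T) (hp : 1 < p)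
    (hK : 0 ≤ K) (hε : 0 < ε) :
    ∫ z, Real.exp (-K * z.2) * (K / 2 * softPos ε ((u₁ - u₂) z) ^ 2) ∂cylMeasure Ω T ≤
      ∫ z, Real.exp (-K * z.2) * ((f₁ - f₂) z * softPos ε ((u₁ - u₂) z)) ∂cylMeasure Ω T := by
  obtain ⟨g₁, hg₁, hg₁_nonpos⟩ := h₁.exists_trace_nonpos
  obtain ⟨g₂, hg₂, hg₂_nonneg⟩ := h₂.exists_trace_nonneg
  obtain ⟨a₁, ha₁, ha₁_le⟩ := h₁.exists_initial_le
  obtain ⟨a₂, ha₂, ha₂_ge⟩ := h₂.exists_le_initial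
  have hw := h₁.memLp_two.sub h₂.memLp_two
  have hwt : HasWeakTimeDeriv Ω T (u₁ - u₂) (ut₁ - ut₂) := h₁.timeDeriv.sub h₂.timeDeriv
    (h₁.memLp_two.locallyIntegrable one_le_two) (h₂.memLp_two.locallyIntegrable one_le_two)
    (h₁.memLp_timeDeriv.locallyIntegrable one_le_two)
    (h₂.memLp_timeDeriv.locallyIntegrable one_le_two)
  have htest := (hg₁.sub hg₂ hp.le h₁.memLp_two.1 h₂.memLp_two.1 h₁.memLp_grad.1
    h₂.memLp_grad.1).memEZero_time_mul_softPos hp.le hw (h₁.memLp_grad.sub h₂.memLp_grad)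
    (by filter_upwards [hg₁_nonpos, hg₂_nonneg] with z hz₁ hz₂ using sub_nonpos.2 (hz₁.trans hz₂))
    (η := fun t => Real.exp (-K * t)) (by fun_prop) hε
  have hsource := h₁.integral_timeDeriv_sub_mul_le h₂ hp htest
    (fun _ => mul_nonneg (Real.exp_pos _).le (softPos_nonneg hε _))
    (fun _ => mul_nonneg (Real.exp_pos _).le (Real.smoothTransition.nonneg _))
  simp only [mul_left_comm _ (Real.exp _)] at hsource
  exact (hwt.integral_exp_mul_sq_softPos_le hΩ hT hK hε hw
    (h₁.memLp_timeDeriv.sub h₂.memLp_timeDeriv)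
    (ha₁.sub ha₂ hT h₁.memLp_two.1 h₂.memLp_two.1) (by
      filter_upwards [ha₁_le, ha₂_ge] with x hx₁ hx₂ using sub_nonpos.2 (hx₁.trans hx₂))).trans
    hsource

lemma tendsto_integral_exp_mul_sq_softPos {w : SpaceTime N → ℝ} (hw : MemLp w 2 (cylMeasure Ω T)) :
    Tendsto (fun ε => ∫ z, Real.exp (-K * z.2) * (K / 2 * softPos ε (w z) ^ 2) ∂cylMeasure Ω T)
      (𝓝[>] 0)
      (𝓝 (∫ z, Real.exp (-K * z.2) * (K / 2 * max (w z) 0 ^ 2) ∂cylMeasure Ω T)) := by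
  have hη : Continuous fun t : ℝ => Real.exp (-K * t) := by fun_prop
  refine tendsto_integral_filter_of_dominated_convergence
    (fun z => Real.exp (-K * z.2) * (|K / 2| * w z ^ 2)) (Eventually.of_forall fun ε => ?_)
    (Eventually.of_forall fun ε => Eventually.of_forall fun z => ?_)
    (integrable_time_mul hη (hw.integrable_sq.const_mul _))
    (Eventually.of_forall fun z => ((((tendsto_softPos (w z)).pow 2).const_mul _).const_mul _))
  · exact (integrable_time_mul hη ((memLp_softPos hw ε).integrable_sq.const_mul (K / 2))).1
  · rw [norm_mul, norm_mul, Real.norm_of_nonneg (Real.exp_pos _).le,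
      Real.norm_of_nonneg (sq_nonneg _), Real.norm_eq_abs]
    gcongr ?_ * (?_ * ?_)
    exact sq_le_sq.2 (abs_softPos_le_abs ε _)

lemma tendsto_integral_exp_mul_mul_softPos {f w : SpaceTime N → ℝ}
    (hf : MemLp f 2 (cylMeasure Ω T)) (hw : MemLp w 2 (cylMeasure Ω T)) :
    Tendsto (fun ε => ∫ z, Real.exp (-K * z.2) * (f z * softPos ε (w z)) ∂cylMeasure Ω T)
      (𝓝[>] 0) (𝓝 (∫ z, Real.exp (-K * z.2) * (f z * max (w z) 0) ∂cylMeasure Ω T)) := by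
  have hη : Continuous fun t : ℝ => Real.exp (-K * t) := by fun_prop
  refine tendsto_integral_filter_of_dominated_convergence
    (fun z => Real.exp (-K * z.2) * ‖f z * w z‖) (Eventually.of_forall fun ε => ?_)
    (Eventually.of_forall fun ε => Eventually.of_forall fun z => ?_)
    (integrable_time_mul hη (hf.integrable_mul hw).norm)
    (Eventually.of_forall fun z => (((tendsto_softPos (w z)).const_mul _).const_mul _))
  · exact (integrable_time_mul hη (hf.integrable_mul (memLp_softPos hw ε))).1
  · rw [norm_mul, norm_mul, norm_mul, Real.norm_of_nonneg (Real.exp_pos _).le]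
    gcongr
    exact abs_softPos_le_abs ε _

theorem IsScalarSubsolution.integral_exp_mul_sq_posPart_le
    (h₁ : IsScalarSubsolution Ω T p f₁ u₀ u₁ ut₁ D₁)
    (h₂ : IsScalarSupersolution Ω T p f₂ u₀ u₂ ut₂ D₂) (hΩ : IsOpen Ω) (hT : 0 < T) (hp : 1 < p)
    (hK : 0 ≤ K) :
    ∫ z, Real.exp (-K * z.2) * (K / 2 * max (u₁ z - u₂ z) 0 ^ 2) ∂cylMeasure Ω T ≤
      ∫ z, Real.exp (-K * z.2) * ((f₁ z - f₂ z) * max (u₁ z - u₂ z) 0) ∂cylMeasure Ω T :=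
  have hw := h₁.memLp_two.sub h₂.memLp_two
  le_of_tendsto_of_tendsto (tendsto_integral_exp_mul_sq_softPos hw)
    (tendsto_integral_exp_mul_mul_softPos (h₁.memLp_source.sub h₂.memLp_source) hw)
    (eventually_mem_nhdsWithin.mono fun _ hε =>
      h₁.integral_exp_mul_sq_softPos_le h₂ hΩ hT hp hK hε)

lemma IsScalarSubsolution.integral_exp_mul_sq_posPart_le_of_source_le
    (h₁ : IsScalarSubsolution Ω T p f₁ u₀ u₁ ut₁ D₁)
    (h₂ : IsScalarSupersolution Ω T p f₂ u₀ u₂ ut₂ D₂) (hΩ : IsOpen Ω) (hT : 0 < T) (hp : 1 < p)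
    (hK : 0 ≤ K) {L : ℝ} {V : SpaceTime N → ℝ} (hV : MemLp V 2 (cylMeasure Ω T))
    (hf : ∀ᵐ z ∂cylMeasure Ω T, f₁ z - f₂ z ≤ L * V z) :
    ∫ z, Real.exp (-K * z.2) * (K / 2 * max (u₁ z - u₂ z) 0 ^ 2) ∂cylMeasure Ω T ≤
      ∫ z, Real.exp (-K * z.2) * (L * (V z * max (u₁ z - u₂ z) 0)) ∂cylMeasure Ω T := by
  have hη : Continuous fun t : ℝ => Real.exp (-K * t) := by fun_prop
  have hpos : MemLp (fun z => max (u₁ z - u₂ z) 0) 2 (cylMeasure Ω T) :=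
    (h₁.memLp_two.sub h₂.memLp_two).pos_part
  refine (h₁.integral_exp_mul_sq_posPart_le h₂ hΩ hT hp hK).trans (integral_mono_ae
    (integrable_time_mul hη ((h₁.memLp_source.sub h₂.memLp_source).integrable_mul hpos))
    (integrable_time_mul hη ((hV.integrable_mul hpos).const_mul L)) ?_)
  filter_upwards [hf] with z hz
  simp only [← mul_assoc L]
  gcongr

end Pair

end ScalarComparison

/-! ### Coupled estimates -/

section Coupling

variable {α : Type*} {mα : MeasurableSpace α} {μ : Measure α} {η U V : α → ℝ} {K L₁ L₂ : ℝ}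

lemma ae_eq_zero_of_coupled_integral_le (hη : ∀ z, 0 < η z)
    (hU : Integrable (fun z => η z * U z ^ 2) μ) (hV : Integrable (fun z => η z * V z ^ 2) μ)
    (hVU : Integrable (fun z => η z * (V z * U z)) μ) (hL₁ : 0 ≤ L₁) (hL₂ : 0 ≤ L₂)
    (hK : L₁ + L₂ < K)
    (hU_le : ∫ z, η z * (K / 2 * U z ^ 2) ∂μ ≤ ∫ z, η z * (L₁ * (V z * U z)) ∂μ)
    (hV_le : ∫ z, η z * (K / 2 * V z ^ 2) ∂μ ≤ ∫ z, η z * (L₂ * (U z * V z)) ∂μ) :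
    ∀ᵐ z ∂μ, U z = 0 ∧ V z = 0 := by
  simp only [mul_left_comm (η _) (K / 2), mul_left_comm (η _) L₁, mul_left_comm (η _) L₂,
    mul_comm (U _) (V _), integral_const_mul] at hU_le hV_le
  have hamgm : ∫ z, η z * (V z * U z) ∂μ ≤
      (∫ z, η z * U z ^ 2 ∂μ + ∫ z, η z * V z ^ 2 ∂μ) / 2 := by
    rw [← integral_add hU hV, ← integral_div]
    refine integral_mono hVU ((hU.add hV).div_const 2) fun z => ?_
    dsimp only
    nlinarith [mul_nonneg (hη z).le (sq_nonneg (U z - V z))]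
  have hU₀ : 0 ≤ fun z => η z * U z ^ 2 := fun z => mul_nonneg (hη z).le (sq_nonneg _)
  have hV₀ : 0 ≤ fun z => η z * V z ^ 2 := fun z => mul_nonneg (hη z).le (sq_nonneg _)
  have hzero : ∫ z, η z * U z ^ 2 ∂μ + ∫ z, η z * V z ^ 2 ∂μ ≤ 0 := by
    have := mul_le_mul_of_nonneg_left hamgm (add_nonneg hL₁ hL₂)
    nlinarith
  have hU_zero := (integral_eq_zero_iff_of_nonneg hU₀ hU).1
    (le_antisymm (by linarith [integral_nonneg (μ := μ) hV₀]) (integral_nonneg hU₀))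
  have hV_zero := (integral_eq_zero_iff_of_nonneg hV₀ hV).1
    (le_antisymm (by linarith [integral_nonneg (μ := μ) hU₀]) (integral_nonneg hV₀))
  filter_upwards [hU_zero, hV_zero] with z hUz hVz
  simpa [(hη z).ne'] using And.intro hUz hVz

end Coupling

end FastDiffusion

end

theorem mainTheorem5_general {N : ℕ} {Ω : Set (FastDiffusion.Space N)} (hΩ : IsOpen Ω) {T : ℝ}
    (hT : 0 < T) {p q m n : ℝ} (hp : 1 < p) (hq : 1 < q) (hm : 0 < m) (hn : 0 < n)
    {u₀ v₀ : FastDiffusion.Space N → ℝ} {uSup vSup uSub vSub : FastDiffusion.SpaceTime N → ℝ}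
    (hSup : FastDiffusion.IsWeakSupersolution Ω T p q m n u₀ v₀ uSup vSup)
    (hSub : FastDiffusion.IsWeakSubsolution Ω T p q m n u₀ v₀ uSub vSub)
    (huSub : FastDiffusion.IsBoundedOn Ω T uSub) (hvSub : FastDiffusion.IsBoundedOn Ω T vSub)
    (hvSup : 1 ≤ m ∨ ∃ δ > 0, ∀ᵐ z ∂(FastDiffusion.cylMeasure Ω T), δ ≤ vSup z)
    (huSup : 1 ≤ n ∨ ∃ δ > 0, ∀ᵐ z ∂(FastDiffusion.cylMeasure Ω T), δ ≤ uSup z) :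
    ∀ᵐ z ∂(FastDiffusion.cylMeasure Ω T), uSub z ≤ uSup z ∧ vSub z ≤ vSup z := by
  obtain ⟨⟨_, _, hu⟩, _, _, hv⟩ := hSub.exists_isScalarSubsolution hm hn
  obtain ⟨⟨_, _, hu'⟩, _, _, hv'⟩ := hSup.exists_isScalarSupersolution hm hn
  obtain ⟨L₁, hL₁, hlip₁⟩ := FastDiffusion.exists_ae_rpow_sub_rpow_le hm hvSub
    (hSub.1.mono fun _ h => h.2) (hSup.1.mono fun _ h => h.2) hvSup
  obtain ⟨L₂, hL₂, hlip₂⟩ := FastDiffusion.exists_ae_rpow_sub_rpow_le hn huSub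
    (hSub.1.mono fun _ h => h.1) (hSup.1.mono fun _ h => h.1) huSup
  have hK : 0 ≤ L₁ + L₂ + 1 := by positivity
  have hexp {f} (hf : Integrable f (FastDiffusion.cylMeasure Ω T)) :
      Integrable (fun z => Real.exp (-(L₁ + L₂ + 1) * z.2) * f z) (FastDiffusion.cylMeasure Ω T) :=
    FastDiffusion.integrable_time_mul (η := fun t => Real.exp (-(L₁ + L₂ + 1) * t))
      (by fun_prop) hf
  have hU := (hu.memLp_two.sub hu'.memLp_two).pos_part
  have hV := (hv.memLp_two.sub hv'.memLp_two).pos_part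
  filter_upwards [FastDiffusion.ae_eq_zero_of_coupled_integral_le (fun _ => Real.exp_pos _)
    (hexp hU.integrable_sq) (hexp hV.integrable_sq) (hexp (hV.integrable_mul hU)) hL₁ hL₂
    (lt_add_one _)
    (hu.integral_exp_mul_sq_posPart_le_of_source_le hu' hΩ hT hp hK hV hlip₁)
    (hv.integral_exp_mul_sq_posPart_le_of_source_le hv' hΩ hT hq hK hU hlip₂)] with z hz
  simpa using hz

theorem mainTheorem5 {N : ℕ} (hN : 1 ≤ N) (Ω : Set (FastDiffusion.Space N))
    (hΩ : FastDiffusion.IsBoundedSmoothDomain Ω) (T : ℝ) (hT : 0 < T)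
    (p q m n : ℝ) (hp : 1 < p ∧ p < 2) (hq : 1 < q ∧ q < 2) (hm : 0 < m) (hn : 0 < n)
    (u₀ v₀ : FastDiffusion.Space N → ℝ)
    (uSup vSup uSub vSub : FastDiffusion.SpaceTime N → ℝ)
    (hSup : FastDiffusion.IsWeakSupersolution Ω T p q m n u₀ v₀ uSup vSup)
    (hSub : FastDiffusion.IsWeakSubsolution Ω T p q m n u₀ v₀ uSub vSub)
    (hSup_bdd : FastDiffusion.IsBoundedOn Ω T uSup ∧ FastDiffusion.IsBoundedOn Ω T vSup)
    (hSub_bdd : FastDiffusion.IsBoundedOn Ω T uSub ∧ FastDiffusion.IsBoundedOn Ω T vSub) :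
    ((∃ δ : ℝ, 0 < δ ∧ ∀ᵐ z ∂(FastDiffusion.cylMeasure Ω T), δ ≤ uSup z ∧ δ ≤ vSup z) →
      ∀ᵐ z ∂(FastDiffusion.cylMeasure Ω T), uSub z ≤ uSup z ∧ vSub z ≤ vSup z) ∧
    (1 ≤ m → 1 ≤ n →
      ∀ᵐ z ∂(FastDiffusion.cylMeasure Ω T), uSub z ≤ uSup z ∧ vSub z ≤ vSup z) :=
  ⟨fun ⟨δ, hδ, hlow⟩ => mainTheorem5_general hΩ.isOpen hT hp.1 hq.1 hm hn hSup hSub hSub_bdd.1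
      hSub_bdd.2 (Or.inr ⟨δ, hδ, hlow.mono fun _ h => h.2⟩)
      (Or.inr ⟨δ, hδ, hlow.mono fun _ h => h.1⟩),
    fun hm₁ hn₁ => mainTheorem5_general hΩ.isOpen hT hp.1 hq.1 hm hn hSup hSub hSub_bdd.1
      hSub_bdd.2 (Or.inl hm₁) (Or.inl hn₁)⟩
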